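/- There are absolute constants $A, K > 0$ such that the following holds. Let $m \ge 2$ be an even integer, write $m = 2^{\ell} o$ with $o$ odd, and let $n \ge 1$. Then there is a cyclic $3$-Gray code $C = (w_1, \dots, w_L)$ over $\mathbb{Z}_m^n$, that is, a sequence of $L \ge 1$ pairwise distinct words of $\mathbb{Z}_m^n$ in which any two cyclically consecutive words ($w_1$ being the successor of $w_L$) differ in at most $3$ coordinates, of length $$L \ge m^n - A \, n \, o^n,$$ and there is a decision assignment tree $T$ on $n$ variables over $\mathbb{Z}_m$ that maps every word of $C$ to its cyclic successor in $C$, such that on every root-to-leaf path $T$ reads at most $$K \left( \log_m n + \mathrm{ord}_o(2) \right)$$ coordinates and at every leaf $T$ writes at most $3$ coordinates. Here $\mathrm{ord}_o(2)$ is the multiplicative order of $2$ modulo $o$ (equal to $1$ if $o = 1$). A decision assignment tree is a rooted $m$-ary tree whose internal nodes are labelled by variables $x_1, \dots, x_n$, the edges out of an internal node being labelled by the distinct elements of $\mathbb{Z}_m$, and whose leaves are labelled by sets of instructions assigning fixed values to some of the variables; on input $x \in \mathbb{Z}_m^n$ one follows from the root the edges labelled by the values of the queried variables and carries out the assignments at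 the leaf that is reached, leaving all other variables unchanged. -/

import Mathlib

/-- A counter over `α`: a cyclic sequence of `length` pairwise distinct elements of `α`. -/
structure CyclicCounter (α : Type*) where
  length : ℕ
  length_pos : 0 < length
  word : Fin length → α
  word_injective : Function.Injective word

namespace CyclicCounter

/-- The word following the word with index `i` in the cyclic order (the last word is followed
by the first one). -/
def nextWord {α : Type*} (C : CyclicCounter α) (i : Fin C.length) : α :=
  C.word (finRotate C.length i)

/-- `C` is a (cyclic) `c`-Gray code: cyclically consecutive words differ in at most `c`
coordinates. -/
def IsQuasiGray {n : ℕ} {D : Type*} [DecidableEq D] (c : ℕ) (C : CyclicCounter (Fin n → D)) :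
    Prop :=
  ∀ i : Fin C.length, hammingDist (C.word i) (C.nextWord i) ≤ c

end CyclicCounter

/-- Decision assignment trees on the variables `x i`, `i : Fin n`, with values in `D`.
An internal node queries a variable and has one child for each value in `D`.
A leaf carries assignment instructions: `a i = some d` stands for the instruction that sets `x i`
to `d`, while `a i = none` means that `x i` is not mentioned. -/
inductive DecisionAssignmentTree (D : Type*) (n : ℕ) where
  | leaf (a : Fin n → Option D) : DecisionAssignmentTree D n
  | node (i : Fin n) (child : D → DecisionAssignmentTree D n) : DecisionAssignmentTree D n

namespace DecisionAssignmentTree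

/-- The output of the execution on the input vector `x`. -/
def run {D : Type*} {n : ℕ} : DecisionAssignmentTree D n → (Fin n → D) → (Fin n → D)
  | leaf a, x => fun i => (a i).getD (x i)
  | node i child, x => (child (x i)).run x

/-- Read complexity: the maximum number of internal nodes on a path from the root to a leaf. -/
def readComplexity {D : Type*} [Fintype D] {n : ℕ} : DecisionAssignmentTree D n → ℕ
  | leaf _ => 0
  | node _ child => 1 + Finset.univ.sup fun d => (child d).readComplexity

/-- Write complexity: the maximum number of assignment instructions in a leaf. -/
def writeComplexity {D : Type*} [Fintype D] {n : ℕ} : DecisionAssignmentTree D n → ℕ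
  | leaf a => (Finset.univ.filter fun i => (a i).isSome = true).card
  | node _ child => Finset.univ.sup fun d => (child d).writeComplexity

/-- `T` computes the counter `C`: it maps every word of `C` to the cyclically next word. -/
def Computes {D : Type*} {n : ℕ} (T : DecisionAssignmentTree D n)
    (C : CyclicCounter (Fin n → D)) : Prop :=
  ∀ i : Fin C.length, T.run (C.word i) = C.nextWord i

end DecisionAssignmentTree

/-! Each symbol of `ZMod m` is split into a pointer digit and a memory cell holding some bits and a
residue (mod `o`, or mod 1). The pointer runs through a cyclic Gray code with `M` states; at its
`j`-th state the `j`-th factor of a fixed product of gates (permutations acting on two cells) is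
applied to the memory. A step reads the pointer and two cells, and writes these two cells and one
pointer coordinate, hence the 3. A full round of the pointer applies the whole product `σ` to the
memory, so if `σ` is a cycle on a set `S` of memories, the counter has length at least `M * S.card`
(`exists_counter_of_gates`). What is needed is a product of at most `M` gates that is a cycle on all
memories but one; then at most `M` words are lost.

For `o = 1` multiplication by a primitive element of a field with `2 ^ N` elements, written as a
linear feedback shift register, is a cycle on the nonzero bit vectors and costs `2 * n` gates
(`exists_lfsr_gates`).

For `o ≥ 3` the register has two cycles, zero and nonzero bits. The residues are attached one at a
time by skew products: if the residues already attached vanish, the next one receives a carry,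
namely +1 if the bits of a fixed cell `k` are all 0 and -1 if they are all 1. The total carry is 1
over the zero cycle and -1 over the other, a unit modulo `o`, so each cycle lifts to a single cycle
(`Equiv.Perm.IsCycleOn.skew`). A final three-cycle merges the two into one that misses a single
memory (`Equiv.Perm.IsCycleOn.join`). Operations conditioned on many cells are built from iterated
commutators of three-cycles with `O(n ^ 2)` gates each (`isGateProd_controlled`). In all `O(n ^ 3)`
gates suffice, so the pointer occupies `O(log_m n + 1)` cells. The order of 2 enters only through
being at least 1. -/

namespace DecisionAssignmentTree

/-! ### Decision trees and counters from orbits -/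

variable {D : Type*} {n : ℕ}

theorem hammingDist_run_le [Fintype D] [DecidableEq D] (T : DecisionAssignmentTree D n)
    (x : Fin n → D) : hammingDist x (T.run x) ≤ T.writeComplexity := by
  induction T with
  | leaf a =>
    refine Finset.card_le_card fun i hi => ?_
    have hi' : x i ≠ (a i).getD (x i) := (Finset.mem_filter.1 hi).2
    refine Finset.mem_filter.2 ⟨Finset.mem_univ _, ?_⟩
    cases h : a i with
    | none => exact absurd (by rw [h]; rfl) hi'
    | some d => rfl
  | node i child ih =>
    exact (ih (x i)).trans
      (Finset.le_sup (f := fun d => (child d).writeComplexity) (Finset.mem_univ (x i)))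

/-- Query the variables in a list, recording the answers in `v`, and continue with `k`. -/
def readList : List (Fin n) → (Fin n → D) → ((Fin n → D) → DecisionAssignmentTree D n) →
    DecisionAssignmentTree D n
  | [], v, k => k v
  | i :: l, v, k => node i fun d => readList l (Function.update v i d) k

theorem run_readList (l : List (Fin n)) (v : Fin n → D)
    (k : (Fin n → D) → DecisionAssignmentTree D n) (x : Fin n → D) :
    (readList l v k).run x = (k fun i => if i ∈ l then x i else v i).run x := by
  induction l generalizing v with
  | nil => simp [readList]
  | cons i l ih =>
    simp only [readList, run, ih]
    congr 2
    ext j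
    by_cases hj : j = i
    · subst hj; simp
    · simp [hj]

theorem readComplexity_readList_le [Fintype D] (l : List (Fin n)) (v : Fin n → D)
    (k : (Fin n → D) → DecisionAssignmentTree D n) (c : ℕ) (hc : ∀ u, (k u).readComplexity ≤ c) :
    (readList l v k).readComplexity ≤ l.length + c := by
  induction l generalizing v with
  | nil => simpa [readList] using hc v
  | cons i l ih =>
    have : (Finset.univ.sup fun d =>
        (readList l (Function.update v i d) k).readComplexity) ≤ l.length + c :=
      Finset.sup_le fun d _ => ih _
    simp only [readList, readComplexity, List.length_cons]
    omega

theorem writeComplexity_readList_le [Fintype D] (l : List (Fin n)) (v : Fin n → D)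
    (k : (Fin n → D) → DecisionAssignmentTree D n) (c : ℕ) (hc : ∀ u, (k u).writeComplexity ≤ c) :
    (readList l v k).writeComplexity ≤ c := by
  induction l generalizing v with
  | nil => simpa [readList] using hc v
  | cons i l ih => exact Finset.sup_le fun d _ => ih _

/-- If, after reading the variables in `R`, one knows variables `a`, `b`, `c` such that `F` changes
no others and the new values depend only on `R`, `a` and `b`, then `F` is computed by a tree that
reads `R.length + 2` variables and writes three. -/
theorem exists_tree_of_local [Fintype D] (F : (Fin n → D) → (Fin n → D)) (R : List (Fin n))
    (a b c : (Fin n → D) → Fin n)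
    (ha : ∀ x y, (∀ i ∈ R, x i = y i) → a x = a y)
    (hb : ∀ x y, (∀ i ∈ R, x i = y i) → b x = b y)
    (hc : ∀ x y, (∀ i ∈ R, x i = y i) → c x = c y)
    (hfix : ∀ x i, i ≠ a x → i ≠ b x → i ≠ c x → F x i = x i)
    (hdep : ∀ x y, (∀ i ∈ R, x i = y i) → x (a x) = y (a x) → x (b x) = y (b x) →
      ∀ i, i = a x ∨ i = b x ∨ i = c x → F x i = F y i) :
    ∃ T : DecisionAssignmentTree D n, T.run = F ∧ T.readComplexity ≤ R.length + 2 ∧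
      T.writeComplexity ≤ 3 := by
  classical
  rcases isEmpty_or_nonempty (Fin n → D) with hE | ⟨⟨v₀⟩⟩
  · exact ⟨leaf fun _ => none, funext fun x => hE.elim x, by simp [readComplexity],
      by simp [writeComplexity]⟩
  let lf : (Fin n → D) → (Fin n → D) → DecisionAssignmentTree D n := fun v u =>
    leaf fun i => if i = a v ∨ i = b v ∨ i = c v then some (F u i) else none
  refine ⟨readList R v₀ fun v => readList [a v, b v] v (lf v), ?_, ?_, ?_⟩
  · funext x
    -- `v` holds the true values on `R` and the irrelevant default `v₀` elsewhere; `a`, `b`, `c`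
    -- agree at `x` and `v`.
    rw [run_readList, run_readList]
    set v : Fin n → D := fun i => if i ∈ R then x i else v₀ i with hv
    have hvR : ∀ i ∈ R, x i = v i := fun i hi => by simp [hv, hi]
    have eqa := ha x v hvR
    have eqb := hb x v hvR
    have eqc := hc x v hvR
    funext i
    simp only [lf, run]
    split_ifs with h
    · refine (hdep x _ ?_ ?_ ?_ i ?_).symm
      · intro j hj
        simp only [hvR j hj]
        split_ifs <;> rfl
      · simp [eqa]
      · simp [eqb]
      · rwa [eqa, eqb, eqc]
    · rw [← eqa, ← eqb, ← eqc] at h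
      push Not at h
      exact (hfix x i h.1 h.2.1 h.2.2).symm
  · exact readComplexity_readList_le _ _ _ 2 fun v =>
      readComplexity_readList_le [a v, b v] v _ 0 fun u => by simp [lf, readComplexity]
  · refine writeComplexity_readList_le _ _ _ 3 fun v =>
      writeComplexity_readList_le _ _ _ 3 fun u => ?_
    simp only [lf, writeComplexity]
    refine (Finset.card_le_card (t := {a v, b v, c v}) fun i hi => ?_).trans Finset.card_le_three
    by_contra h
    simp only [Finset.mem_insert, Finset.mem_singleton] at h
    simp [h] at hi

theorem val_finRotate {k : ℕ} (i : Fin k) : (finRotate k i : ℕ) = ((i : ℕ) + 1) % k := by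
  rcases k with _ | k
  · exact i.elim0
  · rw [finRotate_apply, Fin.val_add_one]
    split_ifs with h
    · simp [h]
    · have := Fin.val_lt_last h
      exact (Nat.mod_eq_of_lt (by omega)).symm

/-- A tree that permutes all words computes the counter formed by an orbit. -/
theorem exists_counter_of_orbit [Fintype D] [DecidableEq D] (T : DecisionAssignmentTree D n)
    (hT : Function.Injective T.run) (x : Fin n → D) :
    ∃ C : CyclicCounter (Fin n → D), C.length = Function.minimalPeriod T.run x ∧
      T.Computes C ∧ ∀ c, T.writeComplexity ≤ c → C.IsQuasiGray c := by
  have hper : x ∈ Function.periodicPts T.run := hT.mem_periodicPts x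
  let C : CyclicCounter (Fin n → D) :=
    { length := Function.minimalPeriod T.run x
      length_pos := Function.minimalPeriod_pos_of_mem_periodicPts hper
      word := fun i => T.run^[i] x
      word_injective := fun i j h =>
        Fin.ext ((Function.iterate_eq_iterate_iff_of_lt_minimalPeriod i.2 j.2).1 h) }
  have hcomp : T.Computes C := by
    intro i
    change T.run (T.run^[i] x) = T.run^[(finRotate C.length i : Fin C.length)] x
    rw [← Function.iterate_succ_apply' T.run, ← Function.iterate_mod_minimalPeriod_eq]
    congr 1
    exact (val_finRotate i).symm
  refine ⟨C, rfl, hcomp, fun c hc i => ?_⟩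
  rw [← hcomp i]
  exact (T.hammingDist_run_le _).trans hc

end DecisionAssignmentTree

/-! ### Gray codes in mixed radix -/

/-- A cyclic Gray code: an enumeration of a product of cyclic groups, periodic modulo its size,
in which one coordinate changes at each step. -/
theorem exists_cyclic_gray_code {n : ℕ} (p : Fin n → ℕ) (hp : ∀ i, 0 < p i)
    (hdvd : ∀ i j, i < j → p i ∣ p j) :
    ∃ w : ℕ → ∀ i, ZMod (p i), (∀ s t, w s = w t ↔ s ≡ t [MOD ∏ i, p i]) ∧
      (∀ v, ∃ t, w t = v) ∧
      (n ≠ 0 → ∀ t, ∃ i, ∀ j, j ≠ i → w (t + 1) j = w t j) := by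
  suffices h : ∃ w : ℕ → ∀ i, ZMod (p i), (∀ s t, w s = w t ↔ s ≡ t [MOD ∏ i, p i]) ∧
      (n ≠ 0 → ∀ t, ∃ i, ∀ j, j ≠ i → w (t + 1) j = w t j) by
    obtain ⟨w, h1, h2⟩ := h
    refine ⟨w, h1, ?_, h2⟩
    have : ∀ i, NeZero (p i) := fun i => ⟨(hp i).ne'⟩
    have hinj : Function.Injective fun t : Fin (∏ i, p i) => w t := fun s t hst =>
      Fin.ext (Nat.ModEq.eq_of_lt_of_lt ((h1 _ _).1 hst) s.2 t.2)
    have hbij := (Fintype.bijective_iff_injective_and_card _).2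
      ⟨hinj, by rw [Fintype.card_pi, Fintype.card_fin]; simp [ZMod.card]⟩
    intro v
    obtain ⟨t, ht⟩ := hbij.2 v
    exact ⟨t, ht⟩
  induction n with
  | zero => exact ⟨fun _ i => i.elim0, fun s t => by simp [Nat.modEq_one], by simp⟩
  | succ k ih =>
    obtain ⟨w, hw, hstep⟩ := ih (fun i => p i.succ) (fun i => hp _)
      fun i j hij => hdvd _ _ (Fin.succ_lt_succ_iff.2 hij)
    set q := p 0 with hq
    have hq0 : 0 < q := hp 0
    rw [Fin.prod_univ_succ, ← hq]
    set M := ∏ i : Fin k, p i.succ with hM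
    -- A single digit is separate: there `M = 1`, and `q ∣ M` may fail.
    rcases Nat.eq_zero_or_pos k with hk | hk
    · subst hk
      refine ⟨fun t => Fin.cons (t : ZMod (p 0)) fun i => i.elim0, fun s t => ?_, fun _ t =>
        ⟨0, fun j hj => absurd (Subsingleton.elim (α := Fin 1) j 0) hj⟩⟩
      rw [Fin.cons_inj]
      simp [hM, ← hq, ZMod.natCast_eq_natCast_iff]
    · have hqM : q ∣ M := (hdvd 0 (Fin.succ ⟨0, hk⟩) (Fin.succ_pos _)).trans
        (Finset.dvd_prod_of_mem (fun i : Fin k => p i.succ) (Finset.mem_univ _))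
      -- Subtracting `t / q` freezes the first digit exactly when the remaining digits advance; `q ∣
      -- M` makes `t / q` modulo `q` periodic with period `q * M`.
      refine ⟨fun t => Fin.cons ((t : ZMod (p 0)) - ((t / q : ℕ) : ZMod (p 0))) (w (t / q)),
        fun s t => ?_, fun _ t => ?_⟩
      · rw [Fin.cons_inj, hw]
        constructor
        · rintro ⟨h1, h2⟩
          have h3 : ((s / q : ℕ) : ZMod (p 0)) = ((t / q : ℕ) : ZMod (p 0)) :=
            (ZMod.natCast_eq_natCast_iff _ _ _).2 (h2.of_dvd hqM)
          rw [h3, sub_left_inj, ZMod.natCast_eq_natCast_iff] at h1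
          have h4 := h2.mul_left' q
          have h5 : s % q = t % q := h1
          rw [← Nat.div_add_mod s q, ← Nat.div_add_mod t q, h5]
          exact h4.add_right _
        · intro h
          have h2 : s / q ≡ t / q [MOD M] := by
            have : s % (q * M) = t % (q * M) := h
            have h6 : s % (q * M) / q = t % (q * M) / q := by rw [this]
            rwa [Nat.mod_mul_right_div_self, Nat.mod_mul_right_div_self] at h6
          refine ⟨?_, h2⟩
          rw [(ZMod.natCast_eq_natCast_iff _ _ _).2 (h2.of_dvd hqM),
            (ZMod.natCast_eq_natCast_iff _ _ _).2 (h.of_dvd (Dvd.intro _ rfl))]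
      · by_cases hc : q ∣ t + 1
        · have h1 : (t + 1) / q = t / q + 1 := Nat.succ_div_of_dvd hc
          obtain ⟨i, hi⟩ := hstep hk.ne' (t / q)
          refine ⟨i.succ, fun j hj => ?_⟩
          refine Fin.cases ?_ (fun j hj => ?_) j hj
          · intro _
            simp [h1]
          · simp only [Fin.cons_succ, h1]
            exact hi j fun h => hj (by rw [h])
        · have h1 : (t + 1) / q = t / q := Nat.succ_div_of_not_dvd hc
          refine ⟨0, fun j hj => ?_⟩
          refine Fin.cases (fun h => absurd rfl h) (fun j _ => ?_) j hj
          simp only [Fin.cons_succ, h1]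

/-! ### Gates driven by a pointer -/

/-- A permutation of a product that changes at most two coordinates, whose new values depend on
the old values of the same two coordinates only. -/
def IsGate {ι : Type*} {E : ι → Type*} (g : Equiv.Perm (∀ i, E i)) : Prop :=
  ∃ a b, (∀ z i, i ≠ a → i ≠ b → g z i = z i) ∧
    ∀ z z', z a = z' a → z b = z' b → g z a = g z' a ∧ g z b = g z' b

theorem isGate_one {ι : Type*} [Nonempty ι] {E : ι → Type*} :
    IsGate (1 : Equiv.Perm (∀ i, E i)) :=
  let ⟨a⟩ := ‹Nonempty ι›
  ⟨a, a, fun _ _ _ _ => rfl, fun _ _ h h' => ⟨h, h'⟩⟩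

theorem List.prod_reverse_take_succ {G : Type*} [Monoid G] (r : List G) (j : ℕ) :
    (r.take (j + 1)).reverse.prod = r.getD j 1 * (r.take j).reverse.prod := by
  rw [List.take_add_one, List.reverse_append, List.prod_append, List.getD_eq_getElem?_getD]
  cases r[j]? <;> simp

/-- If every alphabet symbol encodes a digit of a pointer and a cell of a memory, a pointer
counting through a Gray code can apply the factors of a product of gates one after the other. -/
theorem exists_counter_of_gates {n : ℕ} [NeZero n] {D : Type*} [Fintype D] [DecidableEq D]
    (p : Fin n → ℕ) (hp : ∀ i, 0 < p i) (hdvd : ∀ i j, i < j → p i ∣ p j) (E : Fin n → Type*)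
    (e : ∀ i, D ≃ ZMod (p i) × E i) (l : List (Equiv.Perm (∀ i, E i))) (hl : ∀ g ∈ l, IsGate g)
    (hlen : l.length ≤ ∏ i, p i) (S : Finset (∀ i, E i)) (hS : S.Nonempty)
    (hcyc : l.prod.IsCycleOn S) (R : List (Fin n)) (hR : ∀ i, i ∉ R → p i = 1) :
    ∃ (C : CyclicCounter (Fin n → D)) (T : DecisionAssignmentTree D n),
      C.IsQuasiGray 3 ∧ T.Computes C ∧ (∏ i, p i) * S.card ≤ C.length ∧
        T.readComplexity ≤ R.length + 2 ∧ T.writeComplexity ≤ 3 := by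
  classical
  obtain ⟨w, hw, hsurj, hstep⟩ := exists_cyclic_gray_code p hp hdvd
  specialize hstep (NeZero.ne n)
  set M := ∏ i, p i with hM
  have hM0 : 0 < M := Finset.prod_pos fun i _ => hp i
  choose idx₀ hidx₀ using hsurj
  obtain ⟨idx, hidx⟩ : ∃ idx : (∀ i, ZMod (p i)) → ℕ, ∀ j, idx (w j) = j % M :=
    ⟨fun v => idx₀ v % M, fun j => (hw _ _).1 (hidx₀ _)⟩
  have hwidx : ∀ v, w (idx v) = v := by
    intro v
    rw [← hidx₀ v, hidx]
    exact (hw _ _).2 (Nat.mod_modEq _ _)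
  set r := l.reverse with hr
  -- The rightmost factor acts first, hence the reversal; pointer states left over apply the
  -- identity.
  let g : ℕ → Equiv.Perm (∀ i, E i) := fun j => r.getD j 1
  have hg : ∀ j, IsGate (g j) := by
    intro j
    simp only [g, List.getD_eq_getElem?_getD]
    cases h : r[j]? with
    | none => exact isGate_one
    | some x => exact hl _ (List.mem_reverse.1 (List.mem_of_getElem? h))
  choose ga gb hgfix hgdep using hg
  choose c₀ hc₀ using hstep
  -- Outside `R` the pointer digit is trivial, so there `c₀ j` may be replaced by a coordinate of
  -- the gate. Thus the old symbol at `c j` is always among those read.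
  obtain ⟨c, hc, hcR⟩ : ∃ c : ℕ → Fin n, (∀ j i, i ≠ ga j → i ≠ c j → w (j + 1) i = w j i) ∧
      ∀ j, c j ≠ ga j → c j ∈ R := by
    refine ⟨fun j => if c₀ j ∈ R then c₀ j else ga j, fun j i hia hic => ?_, fun j hj => ?_⟩
    · by_cases hi : i = c₀ j
      · have hiR : i ∉ R := fun hR' => hic (by rw [hi] at hR'; simp [hR', hi])
        have : Subsingleton (ZMod (p i)) := by rw [hR i hiR]; infer_instance
        exact Subsingleton.elim _ _
      · exact hc₀ j i hi
    · by_cases h : c₀ j ∈ R <;> simp_all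
  let v : (Fin n → D) → ∀ i, ZMod (p i) := fun x i => (e i (x i)).1
  let y : (Fin n → D) → ∀ i, E i := fun x i => (e i (x i)).2
  let F : (Fin n → D) → Fin n → D := fun x i =>
    (e i).symm (w (idx (v x) + 1) i, g (idx (v x)) (y x) i)
  have hvF : ∀ x, v (F x) = w (idx (v x) + 1) := fun x => by
    funext i; simp [v, F]
  have hyF : ∀ x, y (F x) = g (idx (v x)) (y x) := fun x => by
    funext i; simp [y, F]
  have hext : ∀ x x', v x = v x' → y x = y x' → x = x' := by
    intro x x' h1 h2
    funext i
    exact (e i).injective (Prod.ext (congr_fun h1 i) (congr_fun h2 i))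
  have hFinj : Function.Injective F := by
    intro x x' h
    have h1 : w (idx (v x) + 1) = w (idx (v x') + 1) := by rw [← hvF, ← hvF, h]
    have h2 : v x = v x' := by
      rw [← hwidx (v x), ← hwidx (v x')]
      exact (hw _ _).2 (Nat.ModEq.add_right_cancel' 1 ((hw _ _).1 h1))
    refine hext x x' h2 ?_
    have h3 : g (idx (v x)) (y x) = g (idx (v x')) (y x') := by rw [← hyF, ← hyF, h]
    rw [h2] at h3
    exact (g _).injective h3
  have hvR : ∀ x x' : Fin n → D, (∀ i ∈ R, x i = x' i) → v x = v x' := by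
    intro x x' h
    funext i
    by_cases hi : i ∈ R
    · simp [v, h i hi]
    · have : Subsingleton (ZMod (p i)) := by rw [hR i hi]; infer_instance
      exact Subsingleton.elim _ _
  obtain ⟨T, hT, hread, hwrite⟩ := DecisionAssignmentTree.exists_tree_of_local F R
    (fun x => ga (idx (v x))) (fun x => gb (idx (v x))) (fun x => c (idx (v x)))
    (fun x x' h => by rw [hvR x x' h]) (fun x x' h => by rw [hvR x x' h])
    (fun x x' h => by rw [hvR x x' h])
    (by
      intro x i h1 h2 h3
      have h4 : w (idx (v x) + 1) i = v x i := by rw [hc _ _ h1 h3, hwidx]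
      simp only [F, hgfix _ _ _ h1 h2, h4, v, y]
      exact (e i).symm_apply_apply _)
    (by
      intro x x' h ha hb i hi
      have h1 : v x = v x' := hvR x x' h
      have h2 := hgdep (idx (v x)) (y x) (y x') (by simp only [y, ha]) (by simp only [y, hb])
      simp only [F]
      rw [← h1]
      congr 2
      by_cases hia : i = ga (idx (v x))
      · rw [hia]; exact h2.1
      by_cases hib : i = gb (idx (v x))
      · rw [hib]; exact h2.2
      have hic : i = c (idx (v x)) := by tauto
      rw [hgfix _ _ _ hia hib, hgfix _ _ _ hia hib]
      have hiR : i ∈ R := hic ▸ hcR _ (hic ▸ hia)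
      simp only [y, h i hiR])
  obtain ⟨y₀, hy₀⟩ := hS
  let x₀ : Fin n → D := fun i => (e i).symm (w 0 i, y₀ i)
  have hvx₀ : v x₀ = w 0 := by funext i; simp [v, x₀]
  have hyx₀ : y x₀ = y₀ := by funext i; simp [y, x₀]
  obtain ⟨C, hClen, hcomp, hgray⟩ := T.exists_counter_of_orbit (hT ▸ hFinj) x₀
  refine ⟨C, T, hgray 3 hwrite, hcomp, ?_, hread, hwrite⟩
  rw [hClen, hT]
  have hv_iter : ∀ k x, v x = w 0 → v (F^[k] x) = w k := by
    intro k x hx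
    induction k with
    | zero => simpa using hx
    | succ k ih =>
      rw [Function.iterate_succ_apply', hvF, ih, hidx]
      exact (hw _ _).2 ((Nat.mod_modEq k M).add_right 1)
  have hy_iter : ∀ j, j ≤ M → ∀ x, v x = w 0 →
      y (F^[j] x) = (r.take j).reverse.prod (y x) := by
    intro j
    induction j with
    | zero => intro _ x _; simp
    | succ j ih =>
      intro hj x hx
      rw [Function.iterate_succ_apply', hyF, hv_iter j x hx, hidx, Nat.mod_eq_of_lt (by omega),
        ih (by omega) x hx, List.prod_reverse_take_succ, Equiv.Perm.mul_apply]
  have hround : ∀ q, y (F^[M * q] x₀) = (l.prod ^ q) y₀ := by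
    intro q
    induction q with
    | zero => simpa using hyx₀
    | succ q ih =>
      have h1 : v (F^[M * q] x₀) = w 0 := by
        rw [hv_iter _ _ hvx₀]
        exact (hw _ _).2 (by simp [Nat.ModEq])
      rw [Nat.mul_succ, Nat.add_comm, Function.iterate_add_apply, hy_iter M le_rfl _ h1, ih,
        List.take_of_length_le (by simpa [hr] using hlen), hr, List.reverse_reverse, pow_succ',
        Equiv.Perm.mul_apply]
  have hper := Function.isPeriodicPt_minimalPeriod F x₀
  have hpos := Function.minimalPeriod_pos_of_mem_periodicPts (hFinj.mem_periodicPts x₀)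
  set k := Function.minimalPeriod F x₀
  -- When the orbit closes, the pointer is back, so `k = M * q`; then `l.prod ^ q` fixes `y₀`, which
  -- forces `S.card ∣ q`.
  have hdvdk : M ∣ k := by
    have h1 := hv_iter k x₀ hvx₀
    rw [hper.eq, hvx₀] at h1
    exact (Nat.modEq_zero_iff_dvd).1 ((hw _ _).1 h1).symm
  obtain ⟨q, hq⟩ := hdvdk
  have h2 := hround q
  rw [← hq, hper.eq, hyx₀] at h2
  have h3 : S.card ∣ q := (hcyc.pow_apply_eq hy₀).1 h2.symm
  have h4 : M * S.card ∣ k := hq ▸ Nat.mul_dvd_mul_left M h3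
  exact Nat.le_of_dvd hpos h4

/-! ### Products of gates and controlled permutations -/

open Equiv

/-- `σ` is a product of at most `k` gates. -/
def IsGateProd {ι : Type*} {E : ι → Type*} (k : ℕ) (σ : Perm (∀ i, E i)) : Prop :=
  ∃ l : List (Perm (∀ i, E i)), (∀ g ∈ l, IsGate g) ∧ l.length ≤ k ∧ l.prod = σ

section Gates

variable {ι : Type*} {E : ι → Type*}

theorem IsGate.isGateProd {g : Perm (∀ i, E i)} (hg : IsGate g) : IsGateProd 1 g :=
  ⟨[g], by simpa using hg, by simp, by simp⟩

theorem IsGateProd.mul {k l : ℕ} {σ τ : Perm (∀ i, E i)} (hσ : IsGateProd k σ)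
    (hτ : IsGateProd l τ) : IsGateProd (k + l) (σ * τ) := by
  obtain ⟨a, ha, hak, rfl⟩ := hσ
  obtain ⟨b, hb, hbl, rfl⟩ := hτ
  refine ⟨a ++ b, fun g hg => ?_, by simp; omega, by simp⟩
  rcases List.mem_append.1 hg with h | h
  · exact ha g h
  · exact hb g h

theorem IsGateProd.mono {k l : ℕ} (hkl : k ≤ l) {σ : Perm (∀ i, E i)} (hσ : IsGateProd k σ) :
    IsGateProd l σ :=
  hσ.imp fun _ h => ⟨h.1, h.2.1.trans hkl, h.2.2⟩

theorem IsGateProd.list_prod {k : ℕ} (l : List (Perm (∀ i, E i)))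
    (hl : ∀ σ ∈ l, IsGateProd k σ) : IsGateProd (l.length * k) l.prod := by
  induction l with
  | nil => exact ⟨[], by simp, by simp, by simp⟩
  | cons σ l ih =>
    rw [List.prod_cons, List.length_cons, Nat.succ_mul, Nat.add_comm]
    exact (hl σ List.mem_cons_self).mul (ih fun τ hτ => hl τ (List.mem_cons_of_mem _ hτ))

variable [DecidableEq ι]

/-- Apply to the coordinate `k` a permutation that depends on the other coordinates. -/
def coordPerm (k : ι) : ((∀ j : {j // j ≠ k}, E j) → Perm (E k)) →* Perm (∀ i, E i) where
  toFun F :=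
    { toFun := fun z => Function.update z k (F (fun j => z j) (z k))
      invFun := fun z => Function.update z k ((F fun j => z j).symm (z k))
      left_inv := fun z => by
        have h : (fun j : {j // j ≠ k} => Function.update z k (F (fun j => z j) (z k)) j) =
            fun j : {j // j ≠ k} => z j := funext fun j => Function.update_of_ne j.2 _ _
        simp [h]
      right_inv := fun z => by
        have h : (fun j : {j // j ≠ k} =>
            Function.update z k ((F fun j => z j).symm (z k)) j) =
            fun j : {j // j ≠ k} => z j := funext fun j => Function.update_of_ne j.2 _ _
        simp [h] }
  map_one' := by ext z i; simp
  map_mul' F G := by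
    ext z i
    have h : (fun j : {j // j ≠ k} => Function.update z k (G (fun j => z j) (z k)) j) =
        fun j : {j // j ≠ k} => z j := funext fun j => Function.update_of_ne j.2 _ _
    simp [h]

theorem coordPerm_apply (k : ι) (F : (∀ j : {j // j ≠ k}, E j) → Perm (E k)) (z : ∀ i, E i) :
    coordPerm k F z = Function.update z k (F (fun j => z j) (z k)) := rfl

theorem coordPerm_apply_same (k : ι) (F : (∀ j : {j // j ≠ k}, E j) → Perm (E k)) (z : ∀ i, E i) :
    coordPerm k F z k = F (fun j => z j) (z k) := by simp [coordPerm_apply]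

theorem coordPerm_apply_of_ne {k i : ι} (h : i ≠ k)
    (F : (∀ j : {j // j ≠ k}, E j) → Perm (E k)) (z : ∀ i, E i) :
    coordPerm k F z i = z i := by simp [coordPerm_apply, h]

theorem isGate_coordPerm (k a : ι) (F : (∀ j : {j // j ≠ k}, E j) → Perm (E k))
    (hF : ∀ z z' : ∀ i, E i, z a = z' a → F (fun j => z j) = F fun j => z' j) :
    IsGate (coordPerm k F) := by
  refine ⟨k, a, fun z i hi _ => coordPerm_apply_of_ne hi F z, fun z z' hk ha => ⟨?_, ?_⟩⟩
  · rw [coordPerm_apply_same, coordPerm_apply_same, hF z z' ha, hk]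
  · by_cases h : a = k
    · subst h
      rw [coordPerm_apply_same, coordPerm_apply_same, hF z z' ha, hk]
    · rw [coordPerm_apply_of_ne h, coordPerm_apply_of_ne h, ha]

/-- Apply `π` to the coordinate `k` if the coordinates in `S` satisfy the predicates `P`. -/
noncomputable def controlled (k : ι) (S : Finset {j // j ≠ k}) (P : ∀ i, E i → Prop)
    (π : Perm (E k)) : Perm (∀ i, E i) :=
  open Classical in coordPerm k fun u => if ∀ j ∈ S, P j (u j) then π else 1

/-- If either condition fails, one pair of mutually inverse factors is trivial and the other pair
cancels. -/
theorem controlled_union_commutator (k : ι) (S₁ S₂ : Finset {j // j ≠ k}) (P : ∀ i, E i → Prop)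
    (α β : Perm (E k)) :
    controlled k (S₁ ∪ S₂) P (α * β * α⁻¹ * β⁻¹) =
      controlled k S₁ P α * controlled k S₂ P β * controlled k S₁ P α⁻¹ *
        controlled k S₂ P β⁻¹ := by
  classical
  unfold controlled
  rw [← map_mul, ← map_mul, ← map_mul]
  congr 1
  funext u
  simp only [Pi.mul_apply, Finset.mem_union, or_imp, forall_and]
  by_cases h₁ : ∀ j ∈ S₁, P j (u j) <;> by_cases h₂ : ∀ j ∈ S₂, P j (u j) 
  · simp only [if_pos h₁, if_pos h₂, if_pos (And.intro h₁ h₂)]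
  · simp only [if_pos h₁, if_neg h₂, if_neg fun h => h₂ (And.right h), mul_one, mul_inv_cancel]
  · simp only [if_neg h₁, if_pos h₂, if_neg fun h => h₁ (And.left h), one_mul, mul_one,
      mul_inv_cancel]
  · simp only [if_neg h₁, if_neg h₂, if_neg fun h => h₁ (And.left h), mul_one]

end Gates

/-- On at least five points every three-cycle is a commutator of three-cycles. -/
theorem Equiv.Perm.IsThreeCycle.exists_commutator {α : Type*} [Fintype α] [DecidableEq α]
    (hα : 5 ≤ Fintype.card α) {γ : Perm α} (hγ : γ.IsThreeCycle) :
    ∃ σ τ : Perm α, σ.IsThreeCycle ∧ τ.IsThreeCycle ∧ γ = σ * τ * σ⁻¹ * τ⁻¹ := by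
  obtain ⟨f⟩ := Function.Embedding.nonempty_of_card_le (α := Fin 5) (β := α) (by simpa using hα)
  let φ : Perm (Fin 5) →* Perm α := Perm.extendDomainHom (Equiv.ofInjective f f.injective)
  have hφ : ∀ π : Perm (Fin 5), π.IsThreeCycle → (φ π).IsThreeCycle := by
    intro π hπ
    rw [Perm.IsThreeCycle] at hπ ⊢
    rw [← hπ]
    exact Perm.cycleType_extendDomain _
  have h₁ : (swap 0 1 * swap 0 3 : Perm (Fin 5)).IsThreeCycle :=
    Perm.isThreeCycle_swap_mul_swap_same (by decide) (by decide) (by decide)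
  have h₂ : (swap 0 2 * swap 0 4 : Perm (Fin 5)).IsThreeCycle :=
    Perm.isThreeCycle_swap_mul_swap_same (by decide) (by decide) (by decide)
  have h₃ : (swap 0 4 * swap 0 3 : Perm (Fin 5)).IsThreeCycle :=
    Perm.isThreeCycle_swap_mul_swap_same (by decide) (by decide) (by decide)
  -- Two three-cycles sharing one point have a three-cycle as commutator; conjugation carries this
  -- instance to `γ`.
  have key : (swap 0 4 * swap 0 3 : Perm (Fin 5)) =
      (swap 0 1 * swap 0 3) * (swap 0 2 * swap 0 4) * (swap 0 1 * swap 0 3)⁻¹ *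
        (swap 0 2 * swap 0 4)⁻¹ := by decide
  have hconj : IsConj (φ (swap 0 4 * swap 0 3)) γ := by
    rw [Perm.isConj_iff_cycleType_eq, (hφ _ h₃).cycleType, hγ.cycleType]
  obtain ⟨g, hg⟩ := isConj_iff.1 hconj
  refine ⟨g * φ (swap 0 1 * swap 0 3) * g⁻¹, g * φ (swap 0 2 * swap 0 4) * g⁻¹, ?_, ?_, ?_⟩
  · rw [Perm.IsThreeCycle, Perm.cycleType_conj]
    exact hφ _ h₁
  · rw [Perm.IsThreeCycle, Perm.cycleType_conj]
    exact hφ _ h₂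
  · rw [← hg, key]
    simp only [map_mul, map_inv]
    group

/-- Barrington's trick: halve the set of controls and write `γ` as a commutator, so doubling the
controls multiplies the cost by 4. With at most one control the permutation is itself a gate. The
cost is thus quadratic in the number of controls. -/
theorem isGateProd_controlled {ι : Type*} [DecidableEq ι] {E : ι → Type*} (k : ι)
    [Fintype (E k)] [DecidableEq (E k)] (hk : 5 ≤ Fintype.card (E k)) (P : ∀ i, E i → Prop)
    (d : ℕ) (S : Finset {j // j ≠ k}) (hS : S.card ≤ 2 ^ d) {γ : Perm (E k)}
    (hγ : γ.IsThreeCycle) : IsGateProd (4 ^ d) (controlled k S P γ) := by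
  classical
  induction d generalizing S γ with
  | zero =>
    refine IsGate.isGateProd ?_
    rcases S.eq_empty_or_nonempty with rfl | ⟨j, hj⟩
    · exact isGate_coordPerm k k _ fun z z' _ => by simp
    · have hSj : S = {j} := by
        refine Finset.eq_singleton_iff_unique_mem.2 ⟨hj, fun i hi => ?_⟩
        exact Finset.card_le_one.1 (by simpa using hS) i hi j hj
      subst hSj
      exact isGate_coordPerm k j _ fun z z' h => by simp [h]
  | succ d ih =>
    obtain ⟨α, β, hα, hβ, rfl⟩ := hγ.exists_commutator hk
    obtain ⟨S₁, hS₁, hc⟩ := Finset.exists_subset_card_eq (s := S) (n := min S.card (2 ^ d))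
      (min_le_left _ _)
    have hS₂ : (S \ S₁).card ≤ 2 ^ d := by
      rw [Finset.card_sdiff_of_subset hS₁]
      rw [pow_succ] at hS
      omega
    have hS₁' : S₁.card ≤ 2 ^ d := by omega
    rw [← Finset.union_sdiff_of_subset hS₁, controlled_union_commutator]
    refine ((((ih _ hS₁' hα).mul (ih _ hS₂ hβ)).mul (ih _ hS₁' hα.inv)).mul
      (ih _ hS₂ hβ.inv)).mono (by rw [pow_succ]; omega)

/-! ### Lifting and joining cycles -/

theorem Equiv.Perm.IsCycleOn.sum_range_pow_apply {α β : Type*} [AddCommMonoid β] {f : Perm α}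
    {s : Finset α} (hf : f.IsCycleOn s) {a : α} (ha : a ∈ s) (φ : α → β) :
    ∑ j ∈ Finset.range s.card, φ ((f ^ j) a) = ∑ b ∈ s, φ b := by
  refine Finset.sum_nbij (fun j => (f ^ j) a) (fun j _ => ?_) (fun i hi j hj h => ?_)
    (fun b hb => ?_) fun _ _ => rfl
  · exact hf.1.perm_pow j |>.mapsTo ha
  · exact Nat.ModEq.eq_of_lt_of_lt ((hf.pow_apply_eq_pow_apply ha).1 h)
      (Finset.mem_range.1 hi) (Finset.mem_range.1 hj)
  · obtain ⟨j, hj, rfl⟩ := hf.exists_pow_eq ha hb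
    exact ⟨j, Finset.mem_coe.2 (Finset.mem_range.2 hj), rfl⟩

/-- A skew product of a cycle with a cyclic group is a cycle if the total shift along the base
cycle is a generator. -/
theorem Equiv.Perm.IsCycleOn.skew {Z : Type*} {o : ℕ} [NeZero o] {f : Perm Z} {S : Finset Z}
    (hf : f.IsCycleOn S) (T : ZMod o → Z → Z) (hT0 : ∀ z, T 0 z = z)
    (hT : ∀ c d z, T c (T d z) = T (c + d) z) (hcomm : ∀ c z, f (T c z) = T c (f z))
    (φ : Z → ZMod o) (hφ : ∀ c z, φ (T c z) = φ z) (u : Perm Z) (hu : ∀ z, u z = T (φ z) z)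
    (hunit : IsUnit (∑ z ∈ S, φ z)) (S' : Set Z) (hS' : ∀ z, z ∈ S' ↔ ∃ c, T c z ∈ S) :
    (f * u).IsCycleOn S' := by
  have hpow : ∀ (k : ℕ) c z, (f ^ k) (T c z) = T c ((f ^ k) z) := by
    intro k
    induction k with
    | zero => intro c z; rfl
    | succ k ih => intro c z; rw [pow_succ', Perm.mul_apply, Perm.mul_apply, ih, hcomm]
  have hiter : ∀ (k : ℕ) z,
      ((f * u) ^ k) z = T (∑ j ∈ Finset.range k, φ ((f ^ j) z)) ((f ^ k) z) := by
    intro k z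
    induction k with
    | zero => simp [hT0]
    | succ k ih =>
      rw [pow_succ', Perm.mul_apply, ih, Perm.mul_apply, hu, hφ, hT, hcomm, Finset.sum_range_succ,
        pow_succ' f, Perm.mul_apply, add_comm]
  have hround : ∀ z, z ∈ S' → ∀ q : ℕ,
      ((f * u) ^ (S.card * q)) z = T (q * ∑ b ∈ S, φ b) z := by
    intro z hz q
    obtain ⟨c, hc⟩ := (hS' z).1 hz
    -- One trip round the base cycle returns to the same point, translated by the total shift;
    -- translates behave alike as `f` commutes with `T` and `φ` is invariant.
    have h1 : ∀ d, ((f * u) ^ S.card) (T d z) = T (∑ b ∈ S, φ b) (T d z) := by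
      intro d
      rw [hiter]
      have h2 : (f ^ S.card) (T d z) = T d z := by
        have h3 : (f ^ S.card) (T c z) = T c z := hf.pow_card_apply hc
        have h4 : T d z = T (d - c) (T c z) := by rw [hT, sub_add_cancel]
        rw [h4, hpow, h3]
      rw [h2]
      congr 1
      rw [← hf.sum_range_pow_apply hc]
      refine Finset.sum_congr rfl fun j _ => ?_
      rw [hpow, hpow, hφ, hφ]
    induction q with
    | zero => simp [hT0]
    | succ q ih =>
      rw [Nat.mul_succ, Nat.add_comm, pow_add, Perm.mul_apply, ih, h1, hT, Nat.cast_succ]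
      congr 1
      ring
  constructor
  · refine Equiv.bijOn _ fun z => ?_
    rw [hS', hS', Perm.mul_apply, hu, hcomm]
    have h1 : ∀ c, T c z ∈ S ↔ T c (f z) ∈ S := by
      intro c
      rw [← hcomm]
      exact_mod_cast hf.apply_mem_iff.symm
    constructor
    · rintro ⟨c, hc⟩
      rw [hT] at hc
      exact ⟨_, (h1 _).2 hc⟩
    · rintro ⟨c, hc⟩
      exact ⟨c - φ z, by rw [hT, sub_add_cancel]; exact (h1 _).1 hc⟩
  · intro z hz z' hz'
    obtain ⟨c, hc⟩ := (hS' z).1 hz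
    obtain ⟨c', hc'⟩ := (hS' z').1 hz'
    obtain ⟨k, -, hk⟩ := hf.exists_pow_eq hc hc'
    obtain ⟨d, hd⟩ : ∃ d, ((f * u) ^ k) z = T d z' := by
      have h5 : (f ^ k) z = T (-c) (T c' z') := by
        rw [← hk, hpow, hT, neg_add_cancel, hT0]
      rw [hiter, h5, hT, hT]
      exact ⟨_, rfl⟩
    have h1 : (f * u).SameCycle z (T d z') := ⟨k, by rw [zpow_natCast, hd]⟩
    -- The leftover translation `d` is made up by whole trips, their number being `d` divided by the
    -- total shift.
    have h2 : (f * u).SameCycle z' (T d z') := by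
      obtain ⟨s, hs⟩ := hunit
      refine ⟨((S.card * (d * ↑s⁻¹ : ZMod o).val : ℕ) : ℤ), ?_⟩
      rw [zpow_natCast, hround z' hz', ZMod.natCast_zmod_val, ← hs, mul_assoc, Units.inv_mul,
        mul_one]
    exact h1.trans h2.symm

/-- Composing with a suitable three-cycle, two cycles are joined to one that misses one point. -/
theorem Equiv.Perm.IsCycleOn.join {Z : Type*} {f c : Perm Z} {C₁ C₂ : Set Z}
    (h₁ : f.IsCycleOn C₁) (h₂ : f.IsCycleOn C₂) [Finite Z] {p q r : Z}
    (hp : p ∈ C₁) (hr : r ∈ C₂) (hqr : f q = r) (hne : q ≠ r) (hd : _root_.Disjoint C₁ C₂)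
    (hcr : c r = q) (hcq : c q = p) (hcp : c p = r)
    (hc : ∀ z, z ≠ p → z ≠ q → z ≠ r → c z = z) :
    (f * c).IsCycleOn ((C₁ ∪ C₂) \ {r}) := by
  have hq : q ∈ C₂ := h₂.apply_mem_iff.1 (hqr ▸ hr)
  have step : ∀ z, z ≠ p → z ≠ q → z ≠ r → (f * c).SameCycle z (f z) := fun z h h' h'' =>
    ⟨1, by rw [zpow_one, Perm.mul_apply, hc z h h' h'']⟩
  have hsucc : ∀ (j : ℕ) z, (f ^ (j + 1)) z = f ((f ^ j) z) := fun j z => by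
    rw [pow_succ', Perm.mul_apply]
  -- The new permutation follows `C₁` from `f p` to `p`, jumps to `f r`, follows `C₂` from there to
  -- `q`, and jumps back to `f p`; `r` becomes a fixed point.
  have a₁ : ∀ z ∈ C₁, (f * c).SameCycle (f p) z := by
    have key : ∀ j : ℕ, (f * c).SameCycle (f p) ((f ^ j) (f p)) := by
      intro j
      induction j with
      | zero => exact Perm.SameCycle.refl _ _
      | succ j ih =>
        rw [hsucc]
        have hmem : (f ^ j) (f p) ∈ C₁ := (h₁.1.perm_pow j).mapsTo (h₁.apply_mem_iff.2 hp)
        by_cases hj : (f ^ j) (f p) = p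
        · rw [hj]
        · exact ih.trans (step _ hj (fun h => hd.le_bot ⟨h ▸ hmem, hq⟩)
            fun h => hd.le_bot ⟨h ▸ hmem, hr⟩)
    intro z hz
    obtain ⟨j, rfl⟩ := h₁.exists_pow_eq' (Set.toFinite _) (h₁.apply_mem_iff.2 hp) hz
    exact key j
  have a₂ : ∀ z ∈ C₂, z ≠ r → (f * c).SameCycle (f r) z := by
    have key : ∀ j : ℕ, (f ^ j) (f r) ≠ r → (f * c).SameCycle (f r) ((f ^ j) (f r)) := by
      intro j
      induction j with
      | zero => exact fun _ => Perm.SameCycle.refl _ _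
      | succ j ih =>
        rw [hsucc]
        intro hj
        have hmem : (f ^ j) (f r) ∈ C₂ := (h₂.1.perm_pow j).mapsTo (h₂.apply_mem_iff.2 hr)
        by_cases hjr : (f ^ j) (f r) = r
        · rw [hjr]
        · exact (ih hjr).trans (step _ (fun h => hd.le_bot ⟨hp, h ▸ hmem⟩)
            (fun h => hj (h ▸ hqr)) hjr)
    intro z hz hzr
    obtain ⟨j, rfl⟩ := h₂.exists_pow_eq' (Set.toFinite _) (h₂.apply_mem_iff.2 hr) hz
    exact key j hzr
  have hlink : (f * c).SameCycle (f p) (f r) := by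
    have hσq : (f * c).SameCycle q (f p) := ⟨1, by rw [zpow_one, Perm.mul_apply, hcq]⟩
    exact hσq.symm.trans (a₂ q hq hne).symm
  have hcmem : ∀ z, c z ∈ C₁ ∪ C₂ ↔ z ∈ C₁ ∪ C₂ := by
    intro z
    by_cases hzp : z = p
    · rw [hzp, hcp]; exact iff_of_true (Or.inr hr) (Or.inl hp)
    by_cases hzq : z = q
    · rw [hzq, hcq]; exact iff_of_true (Or.inl hp) (Or.inr hq)
    by_cases hzr : z = r
    · rw [hzr, hcr]; exact iff_of_true (Or.inr hq) (Or.inr hr)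
    rw [hc z hzp hzq hzr]
  have hall : ∀ z ∈ (C₁ ∪ C₂) \ {r}, (f * c).SameCycle (f p) z := by
    rintro z ⟨hz | hz, hzr⟩
    · exact a₁ z hz
    · exact hlink.trans (a₂ z hz hzr)
  refine ⟨Equiv.bijOn _ fun z => ?_, fun z hz z' hz' => (hall z hz).symm.trans (hall z' hz')⟩
  have hfmem : f (c z) ∈ C₁ ∪ C₂ ↔ c z ∈ C₁ ∪ C₂ := or_congr h₁.apply_mem_iff h₂.apply_mem_iff
  have hfr : f (c z) = r ↔ z = r := by
    have : f (c r) = r := by rw [hcr, hqr]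
    exact ⟨fun h => c.injective (f.injective (h.trans this.symm)), fun h => h ▸ this⟩
  rw [Perm.mul_apply, Set.mem_sdiff, Set.mem_sdiff, hfmem, hcmem, Set.mem_singleton_iff,
    Set.mem_singleton_iff, hfr]

/-! ### Linear feedback shift registers -/

/-- Take a generator `θ` of the multiplicative group. It generates the field, so its minimal
polynomial has degree `N`. -/
theorem exists_primitive_power_basis (N : ℕ) (hN : N ≠ 0) :
    ∃ (θ : GaloisField 2 N) (e : Module.Basis (Fin N) (ZMod 2) (GaloisField 2 N)),
      (∀ j, e j = θ ^ (j : ℕ)) ∧ θ ≠ 0 ∧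
      ∀ x y : GaloisField 2 N, x ≠ 0 → y ≠ 0 → ∃ k : ℕ, y = θ ^ k * x := by
  have : Finite (GaloisField 2 N) := Module.finite_of_finite (ZMod 2)
  obtain ⟨θ, hθ⟩ := @IsCyclic.exists_generator (GaloisField 2 N)ˣ _ _
  have hpow : ∀ x : GaloisField 2 N, x ≠ 0 → ∃ k : ℕ, x = (θ : GaloisField 2 N) ^ k := by
    intro x hx
    obtain ⟨k, hk⟩ := (mem_powers_iff_mem_zpowers.2 (hθ (Units.mk0 x hx)) :
      Units.mk0 x hx ∈ Submonoid.powers θ)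
    exact ⟨k, by rw [← Units.val_pow_eq_pow_val]; exact (congr_arg Units.val hk).symm⟩
  have htop : IntermediateField.adjoin (ZMod 2) {(θ : GaloisField 2 N)} = ⊤ := by
    rw [eq_top_iff]
    intro x _
    by_cases hx : x = 0
    · rw [hx]; exact zero_mem _
    · obtain ⟨k, rfl⟩ := hpow x hx
      exact pow_mem (IntermediateField.mem_adjoin_simple_self _ _) k
  have hdeg : (minpoly (ZMod 2) (θ : GaloisField 2 N)).natDegree = N := by
    rw [← IntermediateField.adjoin.finrank (Algebra.IsIntegral.isIntegral _), htop,
      IntermediateField.finrank_top', GaloisField.finrank 2 hN]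
  have hli := linearIndependent_pow (K := ZMod 2) (θ : GaloisField 2 N)
  rw [hdeg] at hli
  have : Nonempty (Fin N) := ⟨⟨0, Nat.pos_of_ne_zero hN⟩⟩
  refine ⟨θ, basisOfLinearIndependentOfCardEqFinrank hli
    (by rw [Fintype.card_fin, GaloisField.finrank 2 hN]), fun j => by simp, θ.ne_zero,
    fun x y hx hy => ?_⟩
  obtain ⟨k, hk⟩ := hpow (y / x) (div_ne_zero hy hx)
  exact ⟨k, by rw [← hk, div_mul_cancel₀ _ hx]⟩

/-- All the swaps share the point `x`, so those with partners in one cell form a gate on that cell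
and the cell of `x`. The trivial swap of `x` with itself keeps the list uniform. -/
theorem List.formPerm_cons_eq_prod_swap {α : Type*} [DecidableEq α] (x : α) (l : List α)
    (h : (x :: l).Nodup) : List.formPerm (x :: l) = ((x :: l).reverse.map (Equiv.swap x)).prod := by
  have key : List.formPerm (x :: l) = (l.reverse.map (Equiv.swap x)).prod := by
    induction l with
    | nil => simp
    | cons y l ih =>
      have hxl : (x :: l).Nodup := by simp only [List.nodup_cons, List.mem_cons] at h ⊢; tauto
      rw [List.reverse_cons, List.map_append, List.prod_append, ← ih hxl, List.map_singleton,
        List.prod_singleton, List.formPerm_cons_cons]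
      cases l with
      | nil => simp
      | cons z l =>
        have hx : x ∉ z :: l := by simp only [List.nodup_cons, List.mem_cons] at h ⊢; tauto
        have hy : y ∉ z :: l := (List.nodup_cons.1 (List.nodup_cons.1 h).2).1
        have hxz : z ≠ x := fun h => hx (h ▸ List.mem_cons_self)
        have hyz : z ≠ y := fun h => hy (h ▸ List.mem_cons_self)
        rw [List.formPerm_cons_cons, List.formPerm_cons_cons, mul_assoc, mul_swap_eq_swap_mul,
          List.formPerm_apply_of_notMem hx, List.formPerm_apply_of_notMem hy, ← mul_assoc,
          ← mul_assoc, mul_swap_eq_swap_mul, swap_apply_right, swap_apply_of_ne_of_ne hxz hyz]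
  rw [key, List.reverse_cons, List.map_append, List.prod_append,
    List.map_singleton, List.prod_singleton, Equiv.swap_self, ← Perm.one_def, mul_one]

section Bits

variable {B : Type*}

/-- Permute the entries of a bit vector. -/
def permBits : Perm B →* Perm (B → ZMod 2) where
  toFun π := Equiv.arrowCongr π (Equiv.refl _)
  map_one' := rfl
  map_mul' _ _ := rfl

theorem permBits_apply (π : Perm B) (v : B → ZMod 2) (β : B) : permBits π v β = v (π.symm β) := rfl

/-- Add a multiple of `d` to a bit vector, according to its entry at `β`. -/
def addBits (β : B) (d : B → ZMod 2) (hd : d β = 0) : Perm (B → ZMod 2) where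
  toFun v := v + v β • d
  invFun v := v - v β • d
  left_inv v := by simp [hd]
  right_inv v := by simp [hd]

theorem addBits_apply (β : B) (d : B → ZMod 2) (hd : d β = 0) (v : B → ZMod 2) :
    addBits β d hd v = v + v β • d := rfl

/-- A linear feedback shift register of maximal period. -/
theorem exists_lfsr [Fintype B] [DecidableEq B] (x : B) (l : List B) (hl : (x :: l).Nodup)
    (hmem : ∀ β, β ∈ x :: l) :
    ∃ (d : B → ZMod 2) (hd : d x = 0),
      (addBits x d hd * permBits (List.formPerm (x :: l))).IsCycleOn {v | v ≠ 0} := by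
  set xs := x :: l with hxs
  obtain ⟨θ, e₀, he₀, hθ, htrans⟩ := exists_primitive_power_basis xs.length (by simp [hxs])
  let ix : Fin xs.length ≃ B := List.Nodup.getEquivOfForallMemList xs hl hmem
  let e := e₀.reindex ix
  have he : ∀ (j : ℕ) (hj : j < xs.length), e xs[j] = θ ^ j := by
    intro j hj
    have : ix ⟨j, hj⟩ = xs[j] := rfl
    rw [← this]
    simp [e, he₀]
  let Ψ := e.equivFun.symm
  have hΨ : ∀ v, Ψ v = ∑ β, v β • e β := fun v => e.equivFun_symm_apply v
  set π := List.formPerm xs with hπ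
  let c := Ψ.symm (θ ^ xs.length - 1)
  -- Rotation is multiplication by `θ`, except that the top bit returns as `1` instead of `θ ^
  -- xs.length`; the bit now at `x` tells whether to correct.
  have hrot : ∀ v, Ψ (permBits π v) = θ * Ψ v - permBits π v x • (θ ^ xs.length - 1) := by
    intro v
    have h1 : Ψ (permBits π v) = ∑ β, v β • e (π β) := by
      rw [hΨ]
      exact (Equiv.sum_comp π fun β => permBits π v β • e β).symm.trans
        (Finset.sum_congr rfl fun β _ => by rw [permBits_apply, symm_apply_apply])
    have h2 : ∀ β, e (π β) = θ * e β - if π β = x then θ ^ xs.length - 1 else 0 := by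
      intro β
      obtain ⟨j, hj, rfl⟩ := List.getElem_of_mem (hmem β)
      have h3 : π xs[j] = xs[(j + 1) % xs.length]'(Nat.mod_lt _ (by omega)) :=
        List.formPerm_apply_getElem xs hl j hj
      by_cases h : j + 1 = xs.length
      · have h4 : π xs[j] = x := by rw [h3]; simp [h, hxs]
        have h5 : e x = 1 := by simpa [hxs] using he 0 (by simp [hxs])
        rw [if_pos h4, h4, h5, he j hj]
        have h6 : θ ^ xs.length = θ ^ (j + 1) := by rw [h]
        rw [h6]
        ring
      · have hlt : (j + 1) % xs.length = j + 1 := Nat.mod_eq_of_lt (by omega)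
        have h4 : π xs[j] = xs[j + 1]'(by omega) := by rw [h3]; simp [hlt]
        have h5 : π xs[j] ≠ x := by
          rw [h4]
          intro h6
          have h7 : xs[j + 1]'(by omega) = xs[0]'(by omega) := by simpa [hxs] using h6
          exact absurd ((List.Nodup.getElem_inj_iff hl).1 h7) (by omega)
        rw [if_neg h5, h4, he, he j hj]
        ring
    rw [h1, hΨ v, Finset.mul_sum]
    simp only [h2, smul_sub, Finset.sum_sub_distrib, mul_smul_comm]
    congr 1
    rw [Finset.sum_eq_single (π.symm x)]
    · rw [apply_symm_apply, if_pos rfl, permBits_apply, smul_sub]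
    · intro β _ hβ
      rw [if_neg, smul_zero]
      exact fun h => hβ (by rw [← h, symm_apply_apply])
    · simp
  have hstep : ∀ v, Ψ (permBits π v + permBits π v x • c) = θ * Ψ v := by
    intro v
    rw [map_add, map_smul, hrot, LinearEquiv.apply_symm_apply]
    ring
  -- Otherwise a nonzero `v` rotating to `c` would be sent to `c + c = 0`, although multiplication
  -- by `θ` is injective.
  have hc : c x = 0 := by
    by_contra hcx
    have hcx : c x = 1 := by
      generalize c x = t at hcx
      revert t
      decide
    obtain ⟨v, hv⟩ := (permBits π).surjective c
    have h1 := hstep v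
    have h2 : c + c = 0 := by
      funext β
      exact CharTwo.add_self_eq_zero (c β)
    rw [hv, hcx, one_smul, h2, map_zero] at h1
    have h3 : v = 0 := by simpa [hθ] using h1.symm
    rw [← hv, h3] at hcx
    simp [permBits_apply] at hcx
  refine ⟨c, hc, ?_⟩
  set a := addBits x c hc * permBits π with ha
  have haΨ : ∀ v, Ψ (a v) = θ * Ψ v := fun v => hstep v
  have hpowΨ : ∀ (k : ℕ) v, Ψ ((a ^ k) v) = θ ^ k * Ψ v := by
    intro k v
    induction k with
    | zero => simp
    | succ k ih => rw [pow_succ', Perm.mul_apply, haΨ, ih, pow_succ']; ring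
  have hne : ∀ v, v ≠ 0 ↔ Ψ v ≠ 0 := fun v => by simp
  constructor
  · refine Equiv.bijOn _ fun v => ?_
    change a v ≠ 0 ↔ v ≠ 0
    rw [hne, hne v, haΨ]
    simp [hθ]
  · intro v hv v' hv'
    obtain ⟨k, hk⟩ := htrans (Ψ v) (Ψ v') ((hne v).1 hv) ((hne v').1 hv')
    refine ⟨k, Ψ.injective ?_⟩
    rw [zpow_natCast, hpowΨ, hk]

end Bits

/-! ### Memories and gates acting on their bits -/

/-- Memories whose cells hold some bits and a residue. -/
abbrev Memory {n : ℕ} (b o : Fin n → ℕ) := ∀ i, (Fin (b i) → ZMod 2) × ZMod (o i)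

namespace Memory

variable {n : ℕ} {b o : Fin n → ℕ}

/-- The bits of a memory. -/
def bits (z : Memory b o) : (Σ i, Fin (b i)) → ZMod 2 := fun β => (z β.1).1 β.2

theorem ext_bits {z z' : Memory b o} (h : z.bits = z'.bits) (h' : ∀ i, (z i).2 = (z' i).2) :
    z = z' :=
  funext fun i => Prod.ext (funext fun j => congr_fun h ⟨i, j⟩) (h' i)

/-- Apply a permutation to the bits of a memory. -/
def onBits (b o : Fin n → ℕ) :
    Perm ((Σ i, Fin (b i)) → ZMod 2) →* Perm (Memory b o) where
  toFun π :=
    { toFun := fun z i => (fun j => π z.bits ⟨i, j⟩, (z i).2)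
      invFun := fun z i => (fun j => π.symm z.bits ⟨i, j⟩, (z i).2)
      left_inv := fun z => ext_bits (π.symm_apply_apply z.bits) fun _ => rfl
      right_inv := fun z => ext_bits (π.apply_symm_apply z.bits) fun _ => rfl }
  map_one' := rfl
  map_mul' _ _ := rfl

theorem bits_onBits (π : Perm ((Σ i, Fin (b i)) → ZMod 2)) (z : Memory b o) :
    (onBits b o π z).bits = π z.bits := rfl

theorem onBits_apply_snd (π : Perm ((Σ i, Fin (b i)) → ZMod 2)) (z : Memory b o) (i : Fin n) :
    (onBits b o π z i).2 = (z i).2 := rfl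

theorem isGate_onBits_permBits (i₀ i : Fin n) (π : Perm (Σ i, Fin (b i)))
    (hπ : ∀ β, β.1 ≠ i₀ → β.1 ≠ i → π β = β) : IsGate (onBits b o (permBits π)) := by
  have hπ' : ∀ β, β.1 ≠ i₀ → β.1 ≠ i → π.symm β = β := fun β h h' => by
    rw [symm_apply_eq, hπ β h h']
  have hmem : ∀ β, (β.1 = i₀ ∨ β.1 = i) → ((π.symm β).1 = i₀ ∨ (π.symm β).1 = i) := by
    intro β hβ
    by_contra h
    push Not at h
    have h1 := hπ _ h.1 h.2
    rw [apply_symm_apply] at h1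
    rw [← h1] at h
    tauto
  refine ⟨i₀, i, fun (z : Memory b o) k hk hk' => ?_, fun (z z' : Memory b o) h h' => ?_⟩
  · refine Prod.ext (funext fun j => ?_) rfl
    change z.bits (π.symm ⟨k, j⟩) = z.bits ⟨k, j⟩
    rw [hπ' _ hk hk']
  · have hbits : ∀ β, (β.1 = i₀ ∨ β.1 = i) → z.bits (π.symm β) = z'.bits (π.symm β) := by
      intro β hβ
      have h1 : ∀ γ : Σ i, Fin (b i), (γ.1 = i₀ ∨ γ.1 = i) → z.bits γ = z'.bits γ := by
        rintro ⟨k, j⟩ (rfl | rfl)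
        · simp only [bits, h]
        · simp only [bits, h']
      exact h1 _ (hmem β hβ)
    constructor
    · exact Prod.ext (funext fun j => hbits ⟨i₀, j⟩ (Or.inl rfl)) (congr_arg Prod.snd h :)
    · exact Prod.ext (funext fun j => hbits ⟨i, j⟩ (Or.inr rfl)) (congr_arg Prod.snd h' :)

theorem isGate_onBits_addBits (x : Σ i, Fin (b i)) (i : Fin n) (d : (Σ i, Fin (b i)) → ZMod 2)
    (hd : d x = 0) (hdi : ∀ β, β.1 ≠ i → d β = 0) : IsGate (onBits b o (addBits x d hd)) := by
  refine ⟨x.1, i, fun (z : Memory b o) k hk hk' => ?_, fun (z z' : Memory b o) h h' => ?_⟩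
  · refine Prod.ext (funext fun j => ?_) rfl
    change z.bits ⟨k, j⟩ + z.bits x * d ⟨k, j⟩ = z.bits ⟨k, j⟩
    rw [hdi _ hk', mul_zero, add_zero]
  · have h1 : ∀ γ : Σ i, Fin (b i), (γ.1 = x.1 ∨ γ.1 = i) → z.bits γ = z'.bits γ := by
      rintro ⟨k, j⟩ (hk | hk)
      · dsimp at hk
        subst hk
        simp only [bits, h]
      · dsimp at hk
        subst hk
        simp only [bits, h']
    have hbits : ∀ β : Σ i, Fin (b i), (β.1 = x.1 ∨ β.1 = i) →
        z.bits β + z.bits x * d β = z'.bits β + z'.bits x * d β := by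
      intro β hβ
      rw [h1 β hβ, h1 x (Or.inl rfl)]
    constructor
    · exact Prod.ext (funext fun j => hbits ⟨x.1, j⟩ (Or.inl rfl)) (congr_arg Prod.snd h :)
    · exact Prod.ext (funext fun j => hbits ⟨i, j⟩ (Or.inr rfl)) (congr_arg Prod.snd h' :)

/-- Since `d x = 0`, no factor alters the control bit at `x`, and the increments simply add up. -/
theorem prod_addBits (x : Σ i, Fin (b i)) (d : (Σ i, Fin (b i)) → ZMod 2) (hd : d x = 0)
    (L : List (Fin n)) (hL : L.Nodup) :
    (L.map fun i => addBits x (fun β => if β.1 = i then d β else 0) (by simp [hd])).prod =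
      addBits x (fun β => if β.1 ∈ L then d β else 0) (by simp [hd]) := by
  induction L with
  | nil => ext v β; simp [addBits_apply]
  | cons i L ih =>
    rw [List.map_cons, List.prod_cons, ih (List.nodup_cons.1 hL).2]
    have hi : i ∉ L := (List.nodup_cons.1 hL).1
    refine Equiv.ext fun v => funext fun β => ?_
    simp only [Perm.mul_apply, addBits_apply, Pi.add_apply, Pi.smul_apply, smul_eq_mul, hd,
      ite_self, mul_zero, add_zero, List.mem_cons]
    by_cases h : β.1 = i
    · have : β.1 ∉ L := h ▸ hi
      simp [h, hi]
    · simp [h]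

/-- The bits of a memory can run through all nonzero values by means of two gates per cell. -/
theorem exists_lfsr_gates (b o : Fin n → ℕ) (hb : ∃ i, b i ≠ 0) :
    ∃ a : Perm ((Σ i, Fin (b i)) → ZMod 2), a.IsCycleOn {v | v ≠ 0} ∧ a 0 = 0 ∧
      IsGateProd (2 * n) (onBits b o a) := by
  let R : List (Σ i, Fin (b i)) := (List.finRange n).sigma fun i => List.finRange (b i)
  have hRn : R.Nodup := (List.nodup_finRange n).sigma fun i => List.nodup_finRange _
  have hRm : ∀ β, β ∈ R := fun ⟨i, j⟩ => List.mem_sigma.2 ⟨List.mem_finRange i, List.mem_finRange j⟩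
  obtain ⟨i, hi⟩ := hb
  -- `R` lists the bits cell by cell. Reversing it here undoes the reversal in the product of swaps,
  -- which then splits into one block per cell.
  rcases hR : R.reverse with _ | ⟨x, l⟩
  · have h1 := List.mem_reverse.2 (hRm ⟨i, ⟨0, Nat.pos_of_ne_zero hi⟩⟩)
    rw [hR] at h1
    exact absurd h1 List.not_mem_nil
  have hxl : (x :: l).Nodup := hR ▸ List.nodup_reverse.2 hRn
  obtain ⟨d, hd, hcyc⟩ := exists_lfsr x l hxl fun β => hR ▸ List.mem_reverse.2 (hRm β)
  refine ⟨_, hcyc, ?_, ?_⟩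
  · funext β
    simp [addBits_apply, permBits_apply]
  have hrot : List.formPerm (x :: l) = ((List.finRange n).map fun i =>
      (((List.finRange (b i)).map (Sigma.mk i)).map (Equiv.swap x)).prod).prod := by
    rw [List.formPerm_cons_eq_prod_swap x l hxl, ← hR, List.reverse_reverse]
    simp only [R, List.sigma, List.flatMap_def, List.map_flatten, List.prod_flatten, List.map_map,
      Function.comp_def]
  have hadd : addBits x d hd = ((List.finRange n).map fun i =>
      addBits x (fun β => if β.1 = i then d β else 0) (by simp [hd])).prod := by
    rw [prod_addBits x d hd _ (List.nodup_finRange n)]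
    simp
  rw [map_mul, hadd, hrot, map_list_prod, map_list_prod, map_list_prod, two_mul]
  refine IsGateProd.mul ?_ ?_
  · refine (IsGateProd.list_prod (k := 1) _ fun σ hσ => ?_).mono (by simp)
    simp only [List.mem_map] at hσ
    obtain ⟨_, ⟨i, -, rfl⟩, rfl⟩ := hσ
    exact (isGate_onBits_addBits x i _ _ fun β hβ => by simp [hβ]).isGateProd
  · refine (IsGateProd.list_prod (k := 1) _ fun σ hσ => ?_).mono (by simp)
    simp only [List.mem_map] at hσ
    obtain ⟨_, ⟨_, ⟨i, -, rfl⟩, rfl⟩, rfl⟩ := hσ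
    refine (isGate_onBits_permBits x.1 i _ fun β h h' => ?_).isGateProd
    have key : ∀ L : List (Fin (b i)),
        ((L.map (Sigma.mk i)).map (Equiv.swap x)).prod β = β := by
      intro L
      induction L with
      | nil => rfl
      | cons j L ih =>
        rw [List.map_cons, List.map_cons, List.prod_cons, Perm.mul_apply, ih]
        exact swap_apply_of_ne_of_ne (fun h1 => h (by rw [h1])) fun h1 => h' (by rw [h1])
    exact key _

end Memory

/-! ### Carries into residues -/

section Controlled

variable {ι : Type*} {E : ι → Type*} [DecidableEq ι]

open Classical in
theorem controlled_apply_same (k : ι) (S : Finset {j // j ≠ k}) (P : ∀ i, E i → Prop)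
    (π : Perm (E k)) (z : ∀ i, E i) :
    controlled k S P π z k = if ∀ j ∈ S, P j (z j) then π (z k) else z k := by
  rw [controlled, coordPerm_apply_same]
  split_ifs <;> rfl

theorem controlled_apply_of_ne {k i : ι} (h : i ≠ k) (S : Finset {j // j ≠ k})
    (P : ∀ i, E i → Prop) (π : Perm (E k)) (z : ∀ i, E i) : controlled k S P π z i = z i :=
  coordPerm_apply_of_ne h _ z

theorem controlled_inv (k : ι) (S : Finset {j // j ≠ k}) (P : ∀ i, E i → Prop)
    (π : Perm (E k)) : (controlled k S P π)⁻¹ = controlled k S P π⁻¹ := by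
  classical
  rw [controlled, controlled, ← map_inv]
  congr 1
  funext u
  rw [Pi.inv_apply]
  split_ifs <;> simp

end Controlled

namespace Memory

variable {n : ℕ} {b o : Fin n → ℕ}

/-- Add `c` to the residue in cell `i`. -/
def shift (i : Fin n) (c : ZMod (o i)) (z : Memory b o) : Memory b o :=
  Function.update z i ((z i).1, (z i).2 + c)

theorem shift_apply_of_ne {i j : Fin n} (h : j ≠ i) (c : ZMod (o i)) (z : Memory b o) :
    shift i c z j = z j := Function.update_of_ne h _ _

theorem shift_apply_same (i : Fin n) (c : ZMod (o i)) (z : Memory b o) :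
    shift i c z i = ((z i).1, (z i).2 + c) := Function.update_self _ _ _

theorem shift_zero (i : Fin n) (z : Memory b o) : shift i 0 z = z := by
  simp [shift]

theorem shift_shift (i : Fin n) (c d : ZMod (o i)) (z : Memory b o) :
    shift i c (shift i d z) = shift i (c + d) z := by
  simp only [shift, Function.update_self, Function.update_idem]
  rw [add_assoc, add_comm d]

theorem shift_comm {i j : Fin n} (h : i ≠ j) (c : ZMod (o i)) (d : ZMod (o j)) (z : Memory b o) :
    shift i c (shift j d z) = shift j d (shift i c z) := by
  simp only [shift, Function.update_of_ne h, Function.update_of_ne h.symm]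
  exact Function.update_comm h.symm _ _ _

theorem shift_apply_fst (i j : Fin n) (c : ZMod (o i)) (z : Memory b o) :
    (shift i c z j).1 = (z j).1 := by
  by_cases h : j = i
  · subst h; rw [shift_apply_same]
  · rw [shift_apply_of_ne h]

theorem bits_shift (i : Fin n) (c : ZMod (o i)) (z : Memory b o) : (shift i c z).bits = z.bits :=
  funext fun β => congr_fun (shift_apply_fst i β.1 c z) β.2

theorem onBits_shift (a : Perm ((Σ i, Fin (b i)) → ZMod 2)) (i : Fin n) (c : ZMod (o i))
    (z : Memory b o) : onBits b o a (shift i c z) = shift i c (onBits b o a z) := by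
  refine ext_bits ?_ fun j => ?_
  · rw [bits_onBits, bits_shift, bits_shift, bits_onBits]
  · rw [onBits_apply_snd]
    by_cases h : j = i
    · subst h
      rw [shift_apply_same, shift_apply_same, onBits_apply_snd]
    · rw [shift_apply_of_ne h, shift_apply_of_ne h, onBits_apply_snd]

/-- The indicator function of the zero word minus that of the word of ones. -/
def sgn {l : ℕ} (v : Fin l → ZMod 2) : ℤ := (if v = 0 then 1 else 0) - if v = 1 then 1 else 0

/-- The carry into a residue, if the residues in the cells in `L` precede it. -/
def carry (k : Fin n) (L : List (Fin n)) (z : Memory b o) : ℤ :=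
  if ∀ s ∈ L, (z s).2 = 0 then sgn (z k).1 else 0

theorem carry_shift (k : Fin n) {L : List (Fin n)} {i : Fin n} (hi : i ∉ L) (c : ZMod (o i))
    (z : Memory b o) : carry k L (shift i c z) = carry k L z := by
  have h : ∀ s ∈ L, shift i c z s = z s := fun s hs =>
    shift_apply_of_ne (ne_of_mem_of_not_mem hs hi) c z
  simp only [carry, shift_apply_fst]
  congr 1
  exact propext (forall₂_congr fun s hs => by rw [h s hs])

/-- The carry into a residue can be added by a short product of gates. -/
theorem exists_gates_carry [∀ i, NeZero (o i)] {k : Fin n} (hbk : b k ≠ 0) (hok : 3 ≤ o k)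
    {d : ℕ} (hd : n ≤ 2 ^ d) {L : List (Fin n)} {i : Fin n} (hi : i ∉ L) (hik : i ≠ k)
    (hk : k ∈ L) :
    ∃ u : Perm (Memory b o), IsGateProd (2 * 4 ^ d + 2) u ∧
      ∀ z, u z = shift i (carry k L z : ZMod (o i)) z := by
  classical
  have : Fact (1 < o k) := ⟨by omega⟩
  have : Nonempty (Fin (b k)) := ⟨⟨0, Nat.pos_of_ne_zero hbk⟩⟩
  -- `γ` sends `x₀` to `x₁`; the third point `x₂` only serves to make it a three-cycle.
  let x₀ : (Fin (b k) → ZMod 2) × ZMod (o k) := (0, 0)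
  let x₁ : (Fin (b k) → ZMod 2) × ZMod (o k) := (1, 0)
  let x₂ : (Fin (b k) → ZMod 2) × ZMod (o k) := (0, 1)
  have h01 : x₀ ≠ x₁ := by simp [x₀, x₁]
  have h02 : x₀ ≠ x₂ := by simp [x₀, x₂]
  have h12 : x₁ ≠ x₂ := by simp [x₁, x₂]
  let γ := swap x₁ x₀ * swap x₁ x₂
  have hγ : γ.IsThreeCycle := Perm.isThreeCycle_swap_mul_swap_same h01.symm h12 h02
  have hγ₁ : ∀ x, γ x = x₁ ↔ x = x₀ := by
    intro x
    rw [← γ.injective.eq_iff (b := x₀)]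
    have : γ x₀ = x₁ := by
      simp only [γ, Perm.mul_apply]
      rw [swap_apply_of_ne_of_ne h01 h02, swap_apply_right]
    rw [this]
  let C := controlled (E := fun i => (Fin (b i) → ZMod 2) × ZMod (o i)) k
    (Finset.univ.filter fun j => j.1 ∈ L) (fun _ x => x.2 = 0) γ
  let F : ZMod (o i) → (∀ j : {j // j ≠ i}, (Fin (b j) → ZMod 2) × ZMod (o j)) →
      Perm ((Fin (b i) → ZMod 2) × ZMod (o i)) := fun c u =>
    Equiv.prodCongr (Equiv.refl _) (Equiv.addRight (if u ⟨k, hik.symm⟩ = x₁ then c else 0))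
  let G := coordPerm (E := fun i => (Fin (b i) → ZMod 2) × ZMod (o i)) i (F 1)
  have hF : ∀ c, IsGate (coordPerm (E := fun i => (Fin (b i) → ZMod 2) × ZMod (o i)) i (F c)) :=
    fun c => isGate_coordPerm i k _ fun z z' h => by simp only [F, h]
  have hG : IsGate G := hF 1
  have hGinv : IsGate G⁻¹ := by
    have : (F 1)⁻¹ = F (-1) := by
      funext u
      refine inv_eq_of_mul_eq_one_right (Equiv.ext fun x => Prod.ext rfl ?_)
      simp only [F, Perm.mul_apply]
      split_ifs <;> simp
    simp only [G]
    rw [← map_inv, this]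
    exact hF _
  have hcard : 5 ≤ Fintype.card ((Fin (b k) → ZMod 2) × ZMod (o k)) := by
    simp only [Fintype.card_prod, Fintype.card_pi, ZMod.card, Finset.prod_const, Finset.card_univ,
      Fintype.card_fin]
    have : 2 ^ 1 ≤ 2 ^ b k := Nat.pow_le_pow_right (by norm_num) (Nat.pos_of_ne_zero hbk)
    nlinarith
  have hS : (Finset.univ.filter fun j : {j // j ≠ k} => j.1 ∈ L).card ≤ 2 ^ d := by
    refine (Finset.card_le_univ _).trans (le_trans ?_ hd)
    exact (Fintype.card_subtype_le _).trans (by simp)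
  have hC : IsGateProd (4 ^ d) C := isGateProd_controlled k hcard _ d _ hS hγ
  have hCinv : IsGateProd (4 ^ d) C⁻¹ := by
    simp only [C]
    rw [controlled_inv]
    exact isGateProd_controlled k hcard _ d _ hS hγ.inv
  -- `G` adds 1 to residue `i` if cell `k` is `x₁`, and `C` applies `γ` to cell `k` under the
  -- conditions from the other cells in `L`. The net change is `[γ (z k) = x₁] - [z k = x₁]`, that
  -- is `[z k = x₀] - [z k = x₁]`, or 0 if a condition fails.
  refine ⟨G⁻¹ * C⁻¹ * (G * C), (((hGinv.isGateProd.mul hCinv).mul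
    (hG.isGateProd.mul hC)).mono (by omega)), fun z => ?_⟩
  rw [← mul_inv_rev, Perm.mul_apply, Perm.inv_eq_iff_eq, Perm.mul_apply, Perm.mul_apply]
  set w := shift i (carry k L z : ZMod (o i)) z with hw
  have hGk : ∀ z, G z k = z k := fun z => coordPerm_apply_of_ne hik.symm _ z
  have hGj : ∀ z j, j ≠ i → G z j = z j := fun z j hj => coordPerm_apply_of_ne hj _ z
  have hCj : ∀ z j, j ≠ k → C z j = z j := fun z j hj => controlled_apply_of_ne hj _ _ _ z
  have hGi : ∀ z, G z i = ((z i).1, (z i).2 + if z k = x₁ then 1 else 0) := fun z =>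
    coordPerm_apply_same _ _ z
  have hCk : ∀ z, C z k = if ∀ j ∈ L, j ≠ k → (z j).2 = 0 then γ (z k) else z k := by
    intro z
    refine (controlled_apply_same k _ _ _ z).trans ?_
    congr 1
    simp only [Finset.mem_filter, Finset.mem_univ, true_and, Subtype.forall, eq_iff_iff]
    exact ⟨fun h j hj hjk => h j hjk hj, fun h j hjk hj => h j hj hjk⟩
  funext j
  by_cases hji : j = i
  · subst hji
    rw [hGi, hCk, hCj _ _ hik, hCj _ _ hik, hGi, hw, shift_apply_same,
      shift_apply_of_ne hik.symm]
    refine Prod.ext rfl ?_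
    change _ + _ = _ + _ + _
    rw [add_assoc]
    congr 1
    have hall : (∀ s ∈ L, (z s).2 = 0) ↔ (∀ s ∈ L, s ≠ k → (z s).2 = 0) ∧ (z k).2 = 0 := by
      refine ⟨fun h => ⟨fun s hs _ => h s hs, h k hk⟩, fun h s hs => ?_⟩
      by_cases hsk : s = k
      · rw [hsk]; exact h.2
      · exact h.1 s hs hsk
    have hx₀ : z k = x₀ ↔ (z k).1 = 0 ∧ (z k).2 = 0 := Prod.ext_iff
    have hx₁ : z k = x₁ ↔ (z k).1 = 1 ∧ (z k).2 = 0 := Prod.ext_iff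
    simp only [carry, hall, sgn]
    by_cases hc : ∀ s ∈ L, s ≠ k → (z s).2 = 0
    · rw [if_pos hc]
      simp only [hγ₁, hx₀, hx₁, eq_true hc, true_and]
      by_cases hy : (z k).2 = 0 <;> simp [hy]
    · rw [if_neg hc]
      simp only [eq_false hc, false_and, if_false]
      simp
  by_cases hjk : j = k
  · subst hjk
    rw [hGk, hCk, hCk, hGk, hw, shift_apply_of_ne hji]
    congr 1
    refine propext (forall₃_congr fun s hs _ => ?_)
    have hsi : s ≠ i := fun h => hi (h ▸ hs)
    rw [hGj _ _ hsi, shift_apply_of_ne hsi]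
  · rw [hGj _ _ hji, hCj _ _ hjk, hCj _ _ hjk, hGj _ _ hji, hw, shift_apply_of_ne hji]

end Memory

/-! ### The odometer on the residues -/

namespace Memory

variable {n : ℕ} {b o : Fin n → ℕ}

/-- The memories with bits in `X` whose residues outside of the cells in `L` vanish. -/
def level (X : Set ((Σ i, Fin (b i)) → ZMod 2)) (L : List (Fin n)) : Set (Memory b o) :=
  {z | z.bits ∈ X ∧ ∀ i, i ∉ L → (z i).2 = 0}

theorem onBits_isCycleOn {a : Perm ((Σ i, Fin (b i)) → ZMod 2)}
    {X : Set ((Σ i, Fin (b i)) → ZMod 2)} (ha : a.IsCycleOn X) :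
    (onBits b o a).IsCycleOn (level X []) := by
  constructor
  · exact Equiv.bijOn _ fun z => and_congr ha.apply_mem_iff Iff.rfl
  · intro z hz z' hz'
    obtain ⟨k, hk⟩ := ha.2 hz.1 hz'.1
    refine ⟨k, ?_⟩
    rw [← map_zpow]
    refine ext_bits (by rw [bits_onBits, hk]) fun i => ?_
    rw [onBits_apply_snd, hz.2 i List.not_mem_nil, hz'.2 i List.not_mem_nil]

variable [∀ i, NeZero (o i)]

-- Carries vanish unless all residues in `L` do, so the sum does not depend on `L`.
open Classical in
theorem sum_carry (k i : Fin n) (X : Set ((Σ i, Fin (b i)) → ZMod 2)) (L : List (Fin n)) :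
    ∑ z : Memory b o with z ∈ level X L, (carry k L z : ZMod (o i)) =
      ((∑ z : Memory b o with z ∈ level X [], sgn (z k).1 : ℤ) : ZMod (o i)) := by
  rw [← Int.cast_sum]
  congr 1
  simp only [carry]
  rw [← Finset.sum_filter, Finset.filter_filter]
  refine Finset.sum_congr (Finset.filter_congr fun z _ => ?_) fun _ _ => rfl
  simp only [level, Set.mem_ofPred_eq, List.not_mem_nil, not_false_eq_true, forall_const]
  constructor
  · rintro ⟨⟨h, h'⟩, h''⟩
    refine ⟨h, fun i => ?_⟩
    by_cases hi : i ∈ L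
    · exact h'' i hi
    · exact h' i hi
  · rintro ⟨h, h'⟩
    exact ⟨⟨h, fun i _ => h' i⟩, fun i _ => h' i⟩

/-- The skew product lemma for shifts of residue `i`. The total carry is a unit already in `ℤ`,
hence modulo every `o i`. -/
theorem isCycleOn_mul_carry {f : Perm (Memory b o)} {k i : Fin n}
    {X : Set ((Σ i, Fin (b i)) → ZMod 2)} {L : List (Fin n)} (hi : i ∉ L)
    (hf : f.IsCycleOn (level X L)) (hcomm : ∀ c z, f (shift i c z) = shift i c (f z))
    (hX : open Classical in
      IsUnit (∑ z : Memory b o with z ∈ level X [], sgn (z k).1))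
    {u : Perm (Memory b o)} (hu : ∀ z, u z = shift i (carry k L z : ZMod (o i)) z) :
    (f * u).IsCycleOn (level X (i :: L)) := by
  classical
  have hS : ((Finset.univ.filter fun z : Memory b o => z ∈ level X L : Finset (Memory b o)) :
      Set (Memory b o)) = level X L := by simp
  refine Perm.IsCycleOn.skew (S := Finset.univ.filter fun z : Memory b o => z ∈ level X L)
    (by rwa [hS]) (shift i) (shift_zero i) (shift_shift i) hcomm
    (fun z => (carry k L z : ZMod (o i))) (fun c z => by rw [carry_shift k hi]) u hu ?_ _ ?_
  · rw [sum_carry]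
    exact hX.map (Int.castRingHom _)
  · intro z
    simp only [Finset.mem_filter_univ]
    simp only [level, Set.mem_ofPred_eq, bits_shift, List.mem_cons, not_or]
    constructor
    · rintro ⟨h, h'⟩
      refine ⟨-(z i).2, h, fun j hj => ?_⟩
      by_cases hji : j = i
      · subst hji; simp [shift_apply_same]
      · rw [shift_apply_of_ne hji]; exact h' j ⟨hji, hj⟩
    · rintro ⟨c, h, h'⟩
      refine ⟨h, fun j hj => ?_⟩
      rw [← h' j hj.2, shift_apply_of_ne hj.1]

/-- Residues are attached from the end of the list: that of `k` first, driven by the bits of its own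
cell, then each by the carry from all earlier ones. One `f` serves every cycle `X` of `a`, so both
cycles of the register lift together. The explicit value at zero bits supplies the arrow needed to
join them. -/
theorem exists_gates_odometer {k : Fin n} (hbk : b k ≠ 0) (hok : 3 ≤ o k) {d : ℕ}
    (hd : n ≤ 2 ^ d) {a : Perm ((Σ i, Fin (b i)) → ZMod 2)} (ha0 : a 0 = 0) {g : ℕ}
    (hag : IsGateProd g (onBits b o a)) (L : List (Fin n)) (hL : (L ++ [k]).Nodup) :
    ∃ f : Perm (Memory b o), IsGateProd (g + (L ++ [k]).length * (2 * 4 ^ d + 2)) f ∧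
      (∀ i, i ∉ L ++ [k] → ∀ c z, f (shift i c z) = shift i c (f z)) ∧
      (∀ z : Memory b o, z.bits = 0 → (z k).2 ≠ 0 → f z = shift k 1 z) ∧
      ∀ X : Set ((Σ i, Fin (b i)) → ZMod 2), a.IsCycleOn X →
        (open Classical in IsUnit (∑ z : Memory b o with z ∈ level X [], sgn (z k).1)) →
        f.IsCycleOn (level X (L ++ [k])) := by
  classical
  induction L with
  | nil =>
    let F : Perm ((Fin (b k) → ZMod 2) × ZMod (o k)) :=
      { toFun := fun x => (x.1, x.2 + (sgn x.1 : ZMod (o k)))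
        invFun := fun x => (x.1, x.2 - (sgn x.1 : ZMod (o k)))
        left_inv := fun x => by simp
        right_inv := fun x => by simp }
    let u := coordPerm (E := fun i => (Fin (b i) → ZMod 2) × ZMod (o i)) k fun _ => F
    have hu : ∀ z : Memory b o, u z = shift k (carry k [] z : ZMod (o k)) z := by
      intro z
      have h : carry k [] z = sgn (z k).1 := if_pos fun _ h => absurd h List.not_mem_nil
      rw [h]
      rfl
    refine ⟨onBits b o a * u, (hag.mul (isGate_coordPerm k k _ fun _ _ _ => rfl).isGateProd).mono
      (by simp), fun i hi c z => ?_, fun z hz _ => ?_, fun X hX hX' => ?_⟩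
    · have hik : i ≠ k := by simpa using hi
      rw [Perm.mul_apply, Perm.mul_apply, hu, hu, carry_shift k List.not_mem_nil,
        shift_comm hik.symm, onBits_shift]
    · have hsgn : carry k [] z = 1 := by
        have h1 : (z k).1 = 0 := funext fun j => congr_fun hz ⟨k, j⟩
        have h2 : (0 : Fin (b k) → ZMod 2) ≠ 1 := by
          have : Nonempty (Fin (b k)) := ⟨⟨0, Nat.pos_of_ne_zero hbk⟩⟩
          exact zero_ne_one
        simp [carry, sgn, h1, h2]
      rw [Perm.mul_apply, hu, hsgn, Int.cast_one]
      refine ext_bits ?_ fun i => onBits_apply_snd _ _ _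
      rw [bits_onBits, bits_shift, hz, ha0]
    · exact isCycleOn_mul_carry List.not_mem_nil (onBits_isCycleOn hX)
        (fun c z => onBits_shift _ _ _ _) hX' hu
  | cons i L ih =>
    rw [List.cons_append] at hL ⊢
    obtain ⟨f, hfg, hfc, hf0, hfX⟩ := ih (List.nodup_cons.1 hL).2
    have hi : i ∉ L ++ [k] := (List.nodup_cons.1 hL).1
    have hk : k ∈ L ++ [k] := by simp
    obtain ⟨u, hug, hu⟩ := exists_gates_carry (b := b) (o := o) hbk hok hd hi
      (ne_of_mem_of_not_mem hk hi).symm hk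
    refine ⟨f * u, (hfg.mul hug).mono (by rw [List.length_cons]; linarith), fun j hj c z => ?_,
      fun z hz hzk => ?_, fun X hX hX' => ?_⟩
    · rw [List.mem_cons, not_or] at hj
      rw [Perm.mul_apply, Perm.mul_apply, hu, hu, carry_shift k hj.2, shift_comm (Ne.symm hj.1),
        hfc j hj.2]
    · have h1 : carry k (L ++ [k]) z = 0 := if_neg fun h => hzk (h k hk)
      rw [Perm.mul_apply, hu, h1, Int.cast_zero, shift_zero, hf0 z hz hzk]
    · exact isCycleOn_mul_carry hi (hfX X hX hX') (hfc i hi) hX' hu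

open Classical in
theorem sum_sgn_level_zero {k : Fin n} (hbk : b k ≠ 0) :
    ∑ z : Memory b o with z ∈ level {0} [], sgn (z k).1 = 1 := by
  have : Nonempty (Fin (b k)) := ⟨⟨0, Nat.pos_of_ne_zero hbk⟩⟩
  have h : (Finset.univ.filter fun z : Memory b o => z ∈ level {0} []) = {0} := by
    ext z
    simp only [Finset.mem_filter, Finset.mem_univ, true_and, Finset.mem_singleton, level,
      Set.mem_ofPred_eq, Set.mem_singleton_iff]
    constructor
    · rintro ⟨h, h'⟩
      exact ext_bits h fun i => h' i List.not_mem_nil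
    · rintro rfl
      exact ⟨rfl, fun _ _ => rfl⟩
  rw [h, Finset.sum_singleton]
  simp [sgn]

-- Adding 1 to every bit of cell `k` exchanges the all-zero and all-one words, so the sum over all
-- bit vectors is 0; the zero vector contributes 1.
open Classical in
theorem sum_sgn_level_ne_zero {k : Fin n} (hbk : b k ≠ 0) :
    ∑ z : Memory b o with z ∈ level {v | v ≠ 0} [], sgn (z k).1 = -1 := by
  have : Nonempty (Fin (b k)) := ⟨⟨0, Nat.pos_of_ne_zero hbk⟩⟩
  have htot : ∑ z : Memory b o with z ∈ level Set.univ [], sgn (z k).1 = 0 := by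
    let w : Memory b o := Function.update 0 k (1, 0)
    have h1 : ∑ z : Memory b o with z ∈ level Set.univ [], sgn (z k).1 =
        ∑ z : Memory b o with z ∈ level Set.univ [], -sgn (z k).1 := by
      refine Finset.sum_equiv (Equiv.addRight w) (fun z => ?_) fun z _ => ?_
      · simp only [Finset.mem_filter, Finset.mem_univ, true_and, level, Set.mem_univ,
          Set.mem_ofPred_eq]
        refine forall₂_congr fun i _ => ?_
        have : (w i).2 = 0 := by
          by_cases hi : i = k
          · subst hi; simp [w]
          · simp [w, hi]
        simp [this]
      · have h2 : ((Equiv.addRight w) z k).1 = (z k).1 + 1 := by simp [w]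
        have h3 : (1 + 1 : Fin (b k) → ZMod 2) = 0 := funext fun _ => CharTwo.add_self_eq_zero (1 : ZMod 2)
        have h4 : (z k).1 + 1 = 0 ↔ (z k).1 = 1 := by
          rw [← add_left_inj (1 : Fin (b k) → ZMod 2), add_assoc, h3, add_zero, zero_add]
        have h5 : (z k).1 + 1 = 1 ↔ (z k).1 = 0 := by simp
        rw [h2]
        simp only [sgn, h4, h5]
        ring
    rw [Finset.sum_neg_distrib] at h1
    linarith
  have hsplit := Finset.sum_filter_add_sum_filter_not
    (Finset.univ.filter fun z : Memory b o => z ∈ level Set.univ []) (fun z => z.bits = 0)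
    fun z => sgn (z k).1
  rw [htot, Finset.filter_filter, Finset.filter_filter] at hsplit
  have h0 := sum_sgn_level_zero (o := o) hbk
  have e0 : (Finset.univ.filter fun z : Memory b o => z ∈ level Set.univ [] ∧ z.bits = 0) =
      Finset.univ.filter fun z : Memory b o => z ∈ level {0} [] := by
    ext z; simp [level, and_comm]
  have e1 : (Finset.univ.filter fun z : Memory b o => z ∈ level Set.univ [] ∧ ¬z.bits = 0) =
      Finset.univ.filter fun z : Memory b o => z ∈ level {v | v ≠ 0} [] := by
    ext z; simp [level, and_comm]
  rw [e0, e1, h0] at hsplit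
  linarith

/-- A short product of gates can be a cycle through all memories but one. -/
theorem exists_gates_cycle_compl_singleton {k : Fin n} (hbk : b k ≠ 0) (hok : 3 ≤ o k) {d : ℕ}
    (hd : n ≤ 2 ^ d) :
    ∃ (f : Perm (Memory b o)) (r : Memory b o),
      IsGateProd (2 * n + n * (2 * 4 ^ d + 2) + 4 ^ d) f ∧ f.IsCycleOn {r}ᶜ := by
  classical
  obtain ⟨a, hacyc, ha0, hag⟩ := exists_lfsr_gates b o ⟨k, hbk⟩
  let L := (Finset.univ.erase k).toList
  have hL : (L ++ [k]).Nodup := by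
    rw [List.nodup_append]
    refine ⟨Finset.nodup_toList _, List.nodup_singleton _, ?_⟩
    simp [L]
  have hLmem : ∀ i, i ∈ L ++ [k] := by
    intro i
    by_cases hi : i = k <;> simp [L, hi]
  have hLlen : (L ++ [k]).length ≤ n := by
    simpa using hL.length_le_card
  obtain ⟨f, hfg, -, hf0, hfX⟩ := exists_gates_odometer (o := o) hbk hok hd ha0 hag L hL
  have hlevel : ∀ X : Set ((Σ i, Fin (b i)) → ZMod 2),
      level X (L ++ [k]) = {z : Memory b o | z.bits ∈ X} := by
    intro X
    ext z
    simp only [level, hLmem, not_true, false_imp_iff, implies_true, and_true]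
  have h₁ := hfX {v | v ≠ 0} hacyc (by rw [sum_sgn_level_ne_zero hbk]; exact isUnit_one.neg)
  have h₂ := hfX {0} (Perm.isCycleOn_singleton.2 ha0)
    (by rw [sum_sgn_level_zero hbk]; exact isUnit_one)
  rw [hlevel] at h₁ h₂
  have : Fact (1 < o k) := ⟨by omega⟩
  have : Nonempty (Fin (b k)) := ⟨⟨0, Nat.pos_of_ne_zero hbk⟩⟩
  let at_ : ((Fin (b k) → ZMod 2) × ZMod (o k)) → Memory b o := fun x => Function.update 0 k x
  have hat : ∀ x, at_ x k = x := fun x => Function.update_self _ _ _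
  have hat' : ∀ x j, j ≠ k → at_ x j = 0 := fun x j hj => Function.update_of_ne hj _ _
  have hbits : ∀ x, (at_ x).bits = 0 ↔ x.1 = 0 := by
    intro x
    constructor
    · intro h
      funext j
      have := congr_fun h ⟨k, j⟩
      simpa [bits, hat] using this
    · intro h
      funext ⟨i, j⟩
      by_cases hi : i = k
      · subst hi
        simp [bits, hat, h]
      · simp [bits, hat' x i hi]
  -- `pk` lies in the cycle of nonzero bits; `qk` and `rk` lie in the other, and `f` maps the memory
  -- of `qk` to that of `rk` because residue `k` is nonzero, so no carry goes further.
  let pk : (Fin (b k) → ZMod 2) × ZMod (o k) := (1, 0)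
  let qk : (Fin (b k) → ZMod 2) × ZMod (o k) := (0, 1)
  let rk : (Fin (b k) → ZMod 2) × ZMod (o k) := (0, 1 + 1)
  have hpq : qk ≠ pk := by simp [pk, qk]
  have hpr : rk ≠ pk := by simp [pk, rk]
  have hqr : qk ≠ rk := by simp [qk, rk]
  let γ := swap qk rk * swap qk pk
  have hγ : γ.IsThreeCycle := Perm.isThreeCycle_swap_mul_swap_same hqr hpq hpr
  have hγr : γ rk = qk := by
    simp only [γ, Perm.mul_apply]
    rw [swap_apply_of_ne_of_ne hqr.symm hpr, swap_apply_right]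
  have hγq : γ qk = pk := by
    simp only [γ, Perm.mul_apply]
    rw [swap_apply_left, swap_apply_of_ne_of_ne hpq.symm hpr.symm]
  have hγp : γ pk = rk := by
    simp only [γ, Perm.mul_apply]
    rw [swap_apply_right, swap_apply_left]
  have hγx : ∀ x, x ≠ pk → x ≠ qk → x ≠ rk → γ x = x := by
    intro x h h' h''
    simp only [γ, Perm.mul_apply]
    rw [swap_apply_of_ne_of_ne h' h, swap_apply_of_ne_of_ne h' h'']
  let c := controlled (E := fun i => (Fin (b i) → ZMod 2) × ZMod (o i)) k Finset.univ
    (fun _ x => x = 0) γ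
  have hcat : ∀ x, c (at_ x) = at_ (γ x) := by
    intro x
    funext j
    by_cases hj : j = k
    · subst hj
      rw [hat, controlled_apply_same, if_pos fun (i : {i // i ≠ j}) _ => hat' x i.1 i.2, hat]
    · rw [hat' _ _ hj, controlled_apply_of_ne hj, hat' _ _ hj]
  have hcard : 5 ≤ Fintype.card ((Fin (b k) → ZMod 2) × ZMod (o k)) := by
    simp only [Fintype.card_prod, Fintype.card_pi, ZMod.card, Finset.prod_const, Finset.card_univ,
      Fintype.card_fin]
    have : 2 ^ 1 ≤ 2 ^ b k := Nat.pow_le_pow_right (by norm_num) (Nat.pos_of_ne_zero hbk)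
    nlinarith
  have hcg : IsGateProd (4 ^ d) c := by
    refine isGateProd_controlled k hcard _ d _ ?_ hγ
    exact ((Fintype.card_subtype_le _).trans (by simp)).trans hd
  have hjoin := h₁.join h₂ (c := c) (p := at_ pk) (q := at_ qk) (r := at_ rk)
    (fun h => one_ne_zero ((hbits pk).1 h)) ((hbits rk).2 rfl)
    (by
      rw [hf0 _ ((hbits qk).2 rfl) (by rw [hat]; exact one_ne_zero)]
      funext j
      by_cases hj : j = k
      · subst hj
        rw [shift_apply_same, hat, hat]
      · rw [shift_apply_of_ne hj, hat' _ _ hj, hat' _ _ hj])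
    (fun h => hqr (by rw [← hat qk, ← hat rk, h]))
    (Set.disjoint_left.2 fun z hz hz' => hz hz')
    (by rw [hcat, hγr]) (by rw [hcat, hγq]) (by rw [hcat, hγp])
    (by
      intro z h h' h''
      by_cases hz : ∀ j, j ≠ k → z j = 0
      · have hzk : z = at_ (z k) := by
          funext j
          by_cases hj : j = k
          · subst hj; rw [hat]
          · rw [hz j hj, hat' _ _ hj]
        rw [hzk, hcat, hγx]
        · exact fun e => h (by rw [hzk, e])
        · exact fun e => h' (by rw [hzk, e])
        · exact fun e => h'' (by rw [hzk, e])
      · funext j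
        by_cases hj : j = k
        · subst hj
          rw [controlled_apply_same, if_neg]
          exact fun h => hz fun i hi => h ⟨i, hi⟩ (Finset.mem_univ _)
        · rw [controlled_apply_of_ne hj])
  refine ⟨f * c, at_ rk, (hfg.mul hcg).mono ?_, ?_⟩
  · gcongr
  · convert hjoin using 1
    ext z
    simp only [Set.mem_compl_iff, Set.mem_singleton_iff, Set.mem_sdiff, Set.mem_union,
      Set.mem_ofPred_eq]
    tauto

end Memory

/-! ### Dividing the coordinates between pointer and memory -/

namespace Memory

variable {n : ℕ}

theorem exists_counter [NeZero n] {m : ℕ} [NeZero m] (p b o : Fin n → ℕ) [∀ i, NeZero (o i)]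
    (hm : ∀ i, p i * (2 ^ b i * o i) = m) (hdvd : ∀ i j, i < j → p i ∣ p j)
    {σ : Perm (Memory b o)} (hσ : IsGateProd (∏ i, p i) σ) (S : Finset (Memory b o))
    (hS : S.Nonempty) (hcyc : σ.IsCycleOn S) (R : List (Fin n)) (hR : ∀ i, i ∉ R → p i = 1) :
    ∃ (C : CyclicCounter (Fin n → ZMod m)) (T : DecisionAssignmentTree (ZMod m) n),
      C.IsQuasiGray 3 ∧ T.Computes C ∧ (∏ i, p i) * S.card ≤ C.length ∧
        T.readComplexity ≤ R.length + 2 ∧ T.writeComplexity ≤ 3 := by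
  have hp : ∀ i, 0 < p i := fun i => Nat.pos_of_ne_zero fun h => by
    have := hm i
    rw [h, zero_mul] at this
    exact NeZero.ne m this.symm
  have e : ∀ i, Nonempty (ZMod m ≃ ZMod (p i) × ((Fin (b i) → ZMod 2) × ZMod (o i))) := by
    intro i
    have : NeZero (p i) := ⟨(hp i).ne'⟩
    refine Fintype.card_eq.1 ?_
    simp [ZMod.card, ← hm i]
  obtain ⟨l, hl, hlen, rfl⟩ := hσ
  exact exists_counter_of_gates p hp hdvd _ (fun i => (e i).some) l hl hlen S hS hcyc R hR

/-- The number of bits that cell `i` contributes to a memory in which cell `t` has given up `r`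
of `ℓ` bits and the cells after `t` are empty. -/
def bitsBelow (n t ℓ r : ℕ) (i : Fin n) : ℕ := if i < t then ℓ else if i = t then ℓ - r else 0

/-- The modulus of the residue in cell `i` of a memory in which the cells after `t` are empty. -/
def modBelow (n t o : ℕ) (i : Fin n) : ℕ := if (i : ℕ) ≤ t then o else 1

instance (t o : ℕ) [NeZero o] (i : Fin n) : NeZero (modBelow n t o i) := by
  unfold modBelow
  split_ifs <;> infer_instance

/-- The pointer consists of `r` bits of cell `t` and all of the last `s` cells; its digit sizes `1 ∣
2 ^ r ∣ m` suit the Gray code. The missing memory `z₀` costs one word per pointer state. -/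
theorem exists_counter_of_pointer {m ℓ o s r t : ℕ} [NeZero m] [NeZero o] (hm : m = 2 ^ ℓ * o)
    (hr : r ≤ ℓ) (hn : n = t + 1 + s)
    {σ : Perm (Memory (bitsBelow n t ℓ r) (modBelow n t o))}
    (hσ : IsGateProd (2 ^ r * m ^ s) σ) (z₀ : Memory (bitsBelow n t ℓ r) (modBelow n t o))
    (hcyc : σ.IsCycleOn {z₀}ᶜ) (hne : ∃ z, z ≠ z₀) :
    ∃ (C : CyclicCounter (Fin n → ZMod m)) (T : DecisionAssignmentTree (ZMod m) n),
      C.IsQuasiGray 3 ∧ T.Computes C ∧ m ^ n ≤ C.length + 2 ^ r * m ^ s ∧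
        T.readComplexity ≤ s + 3 ∧ T.writeComplexity ≤ 3 := by
  classical
  have : NeZero n := ⟨by omega⟩
  let p : Fin n → ℕ := fun i => if (i : ℕ) < t then 1 else if (i : ℕ) = t then 2 ^ r else m
  have hp : ∏ i, p i = 2 ^ r * m ^ s := by
    simp only [p]
    rw [Fin.prod_univ_eq_prod_range (fun i => if i < t then 1 else if i = t then 2 ^ r else m) n,
      hn, Finset.prod_range_add, Finset.prod_range_succ, Finset.prod_eq_one fun i hi =>
        if_pos (Finset.mem_range.1 hi), one_mul]
    congr 1
    · simp
    · rw [Finset.prod_congr rfl fun i _ => by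
        rw [if_neg (by omega : ¬t + 1 + i < t), if_neg (by omega : t + 1 + i ≠ t)]]
      simp
  have hpm : ∀ i, p i * (2 ^ bitsBelow n t ℓ r i * modBelow n t o i) = m := by
    intro i
    simp only [p, bitsBelow, modBelow]
    rcases lt_trichotomy (i : ℕ) t with h | h | h
    · simp [h, h.le, hm]
    · rw [if_neg h.not_lt, if_neg h.not_lt, if_pos h, if_pos h, if_pos h.le, ← mul_assoc, ← pow_add,
        Nat.add_sub_cancel' hr, hm]
    · simp [h.not_gt, h.ne', h.not_ge]
  have hpow : 2 ^ r ∣ m := hm ▸ Dvd.dvd.mul_right (pow_dvd_pow 2 hr) o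
  have hdvd : ∀ i j, i < j → p i ∣ p j := by
    intro i j hij
    have hij' : (i : ℕ) < j := hij
    simp only [p]
    split_ifs <;> first | omega | simp
  have htot : (∏ i, p i) * Fintype.card (Memory (bitsBelow n t ℓ r) (modBelow n t o)) = m ^ n := by
    rw [Fintype.card_pi, ← Finset.prod_mul_distrib, Finset.prod_congr rfl fun i _ => by
      rw [Fintype.card_prod, ZMod.card, Fintype.card_fun, ZMod.card, Fintype.card_fin, hpm i]]
    simp
  let R : List (Fin n) := (List.finRange (s + 1)).map fun j : Fin (s + 1) => ⟨t + j, by have := j.2; omega⟩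
  obtain ⟨C, T, h1, h2, h3, h4, h5⟩ := exists_counter p _ _ hpm hdvd (hp ▸ hσ)
    ({z₀}ᶜ : Finset (Memory (bitsBelow n t ℓ r) (modBelow n t o)))
    (hne.imp fun z hz => by simpa using hz) (by simpa using hcyc) R (by
      intro i hi
      have h : (i : ℕ) < t := by
        by_contra h
        refine hi (List.mem_map.2 ⟨⟨i - t, by omega⟩, List.mem_finRange _, Fin.ext ?_⟩)
        simp only
        omega
      simp [p, h])
  refine ⟨C, T, h1, h2, ?_, by simpa [R] using h4, h5⟩
  rw [Finset.card_compl, Finset.card_singleton, Nat.mul_sub, mul_one, htot, hp] at h3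
  omega

end Memory

/-! ### Few coordinates, powers of two, and odd part at least three -/

/-- A Gray code through all words, computed by reading all coordinates. -/
theorem exists_full_counter (n m : ℕ) [NeZero n] [NeZero m] :
    ∃ (C : CyclicCounter (Fin n → ZMod m)) (T : DecisionAssignmentTree (ZMod m) n),
      C.IsQuasiGray 3 ∧ T.Computes C ∧ m ^ n ≤ C.length ∧ T.readComplexity ≤ n + 2 ∧
        T.writeComplexity ≤ 3 := by
  classical
  have hsub : Subsingleton (Memory (n := n) (fun _ => 0) fun _ => 1) := by
    unfold Memory
    infer_instance
  -- Every symbol is entirely a pointer digit; the memory is a single point and no gates are needed.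
  obtain ⟨C, T, h1, h2, h3, h4, h5⟩ := Memory.exists_counter (n := n) (m := m) (fun _ => m)
    (fun _ => 0) (fun _ => 1) (by simp) (by simp) (σ := 1) ⟨[], by simp, by simp, rfl⟩ {0}
    (Finset.singleton_nonempty _) (Perm.isCycleOn_of_subsingleton _ _) (List.finRange n)
    fun i hi => absurd (List.mem_finRange i) hi
  exact ⟨C, T, h1, h2, by simpa using h3, by simpa using h4, h5⟩

/-- Powers of two: a counter that misses `O(n)` words. -/
theorem exists_counter_two_pow {n ℓ : ℕ} (hn : 20 ≤ n) (hℓ : ℓ ≠ 0) :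
    ∃ s, (2 ^ ℓ) ^ s ≤ 4 * n ∧
    ∃ (C : CyclicCounter (Fin n → ZMod (2 ^ ℓ))) (T : DecisionAssignmentTree (ZMod (2 ^ ℓ)) n),
      C.IsQuasiGray 3 ∧ T.Computes C ∧ (2 ^ ℓ) ^ n ≤ C.length + 4 * n ∧
        T.readComplexity ≤ s + 3 ∧ T.writeComplexity ≤ 3 := by
  set k := Nat.clog 2 (2 * n) with hk
  have hk1 : 2 * n ≤ 2 ^ k := Nat.le_pow_clog (by norm_num) _
  have hk0 : 0 < k := Nat.clog_pos (by norm_num) (by omega)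
  have hk2 : 2 ^ k ≤ 4 * n := by
    have h := Nat.pow_pred_clog_lt_self (b := 2) (by norm_num) (x := 2 * n) (by omega)
    rw [← hk] at h
    obtain ⟨j, hj⟩ := Nat.exists_eq_succ_of_ne_zero hk0.ne'
    rw [hj] at h ⊢
    rw [Nat.pred_succ] at h
    rw [pow_succ]
    omega
  have hkn : k < n := by
    refine (Nat.pow_lt_pow_iff_right (a := 2) (by norm_num)).1 (hk2.trans_lt ?_)
    clear_value k
    clear hk hk1 hk0 hk2
    induction n, hn using Nat.le_induction with
    | base => norm_num
    | succ n hn ih => rw [pow_succ]; omega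
  -- The pointer has `2 ^ k` states, enough for `2 * n` gates. As `r < ℓ`, cell `t` keeps at least
  -- one bit.
  obtain ⟨s, r, hrs, hrℓ, hsn⟩ : ∃ s r, 2 ^ r * (2 ^ ℓ) ^ s = 2 ^ k ∧ r < ℓ ∧ s < n :=
    ⟨k / ℓ, k % ℓ, by rw [← pow_mul, ← pow_add, Nat.mod_add_div],
      Nat.mod_lt _ (Nat.pos_of_ne_zero hℓ), (Nat.div_le_self k ℓ).trans_lt hkn⟩
  refine ⟨s, le_trans ?_ hk2, ?_⟩
  · rw [← hrs]
    exact Nat.le_mul_of_pos_left _ (by positivity)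
  set t := n - 1 - s with ht
  have hb : Memory.bitsBelow n t ℓ r ⟨t, by omega⟩ ≠ 0 := by
    simp [Memory.bitsBelow]
    omega
  obtain ⟨a, hacyc, -, hag⟩ := Memory.exists_lfsr_gates (Memory.bitsBelow n t ℓ r)
    (Memory.modBelow n t 1) ⟨_, hb⟩
  have hsub : ∀ i, Subsingleton (ZMod (Memory.modBelow n t 1 i)) := fun i => by
    have : Memory.modBelow n t 1 i = 1 := by simp [Memory.modBelow]
    rw [this]
    infer_instance
  have hlevel : (Memory.level {v | v ≠ 0} [] :
      Set (Memory (Memory.bitsBelow n t ℓ r) (Memory.modBelow n t 1))) = {0}ᶜ := by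
    ext z
    have hz : z.bits = 0 ↔ z = 0 :=
      ⟨fun h => Memory.ext_bits h fun i => Subsingleton.elim _ _, fun h => by rw [h]; rfl⟩
    simp only [Memory.level, Set.mem_ofPred_eq, Set.mem_compl_iff, Set.mem_singleton_iff, ne_eq, hz]
    exact and_iff_left fun i _ => Subsingleton.elim _ _
  have hcyc := Memory.onBits_isCycleOn (o := Memory.modBelow n t 1) hacyc
  rw [hlevel] at hcyc
  obtain ⟨C, T, h1, h2, h3, h4, h5⟩ := Memory.exists_counter_of_pointer (m := 2 ^ ℓ) (o := 1)
    (by simp) hrℓ.le (by omega : n = t + 1 + s) (hag.mono (by rw [hrs]; exact hk1)) 0 hcyc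
    ⟨Function.update 0 ⟨t, by omega⟩ (1, 0), fun h => by
      have h' := congr_arg Prod.fst (congr_fun h ⟨t, by omega⟩)
      rw [Function.update_self] at h'
      exact one_ne_zero (congr_fun h' ⟨0, Nat.pos_of_ne_zero hb⟩)⟩
  exact ⟨C, T, h1, h2, by omega, h4, h5⟩

theorem pow_five_le_three_pow {n : ℕ} (hn : 20 ≤ n) : n ^ 5 ≤ 3 ^ (n - 1) := by
  induction n, hn using Nat.le_induction with
  | base => norm_num
  | succ n hn ih =>
    have h : (n + 1) ^ 5 ≤ 3 * n ^ 5 := by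
      have h2 : 5 * (n + 1) ≤ 6 * n := by omega
      have h3 : (5 * (n + 1)) ^ 5 ≤ (6 * n) ^ 5 := Nat.pow_le_pow_left h2 5
      rw [mul_pow, mul_pow] at h3
      have : 0 ≤ n ^ 5 := Nat.zero_le _
      norm_num at h3
      omega
    have h' : 3 ^ (n + 1 - 1) = 3 * 3 ^ (n - 1) := by
      rw [← pow_succ']
      congr 1
      omega
    omega

theorem sixteen_mul_cube_le_two_pow {n : ℕ} (hn : 20 ≤ n) : 16 * n ^ 3 ≤ 2 ^ (n - 2) := by
  induction n, hn using Nat.le_induction with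
  | base => norm_num
  | succ n hn ih =>
    have h : (n + 1) ^ 3 ≤ 2 * n ^ 3 := by nlinarith [Nat.mul_le_mul hn hn]
    have h' : 2 ^ (n + 1 - 2) = 2 * 2 ^ (n - 2) := by
      rw [← pow_succ']
      congr 1
      omega
    omega

theorem Nat.pow_clog_le_mul {b x : ℕ} (hb : 1 < b) (hx : 1 < x) : b ^ Nat.clog b x ≤ b * x := by
  have h := Nat.pow_pred_clog_lt_self hb hx
  obtain ⟨j, hj⟩ := Nat.exists_eq_succ_of_ne_zero (Nat.clog_pos hb hx).ne'
  rw [hj] at h ⊢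
  rw [Nat.pred_succ] at h
  rw [pow_succ, mul_comm]
  exact Nat.mul_le_mul_left _ h.le

theorem exists_counter_odd_ge_three {n m ℓ o : ℕ} [NeZero m] (hm : m = 2 ^ ℓ * o) (hn : 20 ≤ n)
    (hℓ : ℓ ≠ 0) (ho : 3 ≤ o) :
    ∃ s, m ^ (s - 1) ≤ 16 * n ^ 3 ∧
    ∃ (C : CyclicCounter (Fin n → ZMod m)) (T : DecisionAssignmentTree (ZMod m) n),
      C.IsQuasiGray 3 ∧ T.Computes C ∧ m ^ n ≤ C.length + 256 * (n * o ^ n) ∧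
        T.readComplexity ≤ s + 3 ∧ T.writeComplexity ≤ 3 := by
  have : NeZero o := ⟨by omega⟩
  have h2ℓ : 2 ≤ 2 ^ ℓ := by
    simpa using Nat.pow_le_pow_right (n := 2) (by norm_num) (Nat.pos_of_ne_zero hℓ)
  have hm6 : 6 ≤ m := by
    rw [hm]
    exact Nat.mul_le_mul h2ℓ ho
  have hn3 : 20 ^ 3 ≤ n ^ 3 := Nat.pow_le_pow_left hn 3
  have hpos : 1 < 16 * n ^ 3 := by omega
  obtain ⟨s, r, hr, hs, hlow, hread, hloss⟩ : ∃ s r, r ≤ ℓ ∧ s ≤ n - 2 ∧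
      16 * n ^ 3 ≤ 2 ^ r * m ^ s ∧ m ^ (s - 1) ≤ 16 * n ^ 3 ∧
      2 ^ r * m ^ s ≤ 256 * n ^ 6 * o := by
    -- A large power of two must not be spent on a whole pointer cell, as `m` words could then
    -- exceed the allowed loss; some bits of one cell suffice. Otherwise `m ≤ 16 * n ^ 3 * o`, and
    -- rounding up to whole cells costs at most a factor `m`.
    by_cases h : 16 * n ^ 3 ≤ 2 ^ ℓ
    · refine ⟨0, Nat.clog 2 (16 * n ^ 3), ?_, Nat.zero_le _, ?_, by simp; omega, ?_⟩
      · exact (Nat.clog_le_iff_le_pow (by norm_num)).2 h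
      · simpa using Nat.le_pow_clog (by norm_num) _
      · have h1 := Nat.pow_clog_le_mul (b := 2) (by norm_num) hpos
        have h2 : n ^ 6 = n ^ 3 * n ^ 3 := by ring
        rw [pow_zero, mul_one, h2]
        nlinarith
    · refine ⟨Nat.clog m (16 * n ^ 3), 0, Nat.zero_le _, ?_, ?_, ?_, ?_⟩
      · refine (Nat.clog_le_iff_le_pow (by omega)).2 ?_
        exact (sixteen_mul_cube_le_two_pow hn).trans (Nat.pow_le_pow_left (by omega) _)
      · simpa using Nat.le_pow_clog (by omega) _
      · exact (Nat.pow_pred_clog_lt_self (by omega) hpos).le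
      · have h1 := Nat.pow_clog_le_mul (b := m) (by omega) hpos
        rw [pow_zero, one_mul]
        refine h1.trans ?_
        have h2 : m ≤ 16 * n ^ 3 * o := by
          rw [hm]
          exact Nat.mul_le_mul_right _ (by omega)
        calc m * (16 * n ^ 3) ≤ 16 * n ^ 3 * o * (16 * n ^ 3) := Nat.mul_le_mul_right _ h2
          _ = 256 * n ^ 6 * o := by ring
  refine ⟨s, hread, ?_⟩
  have hloss' : 2 ^ r * m ^ s ≤ 256 * (n * o ^ n) := by
    refine hloss.trans ?_
    have h1 : n ^ 5 ≤ o ^ (n - 1) := (pow_five_le_three_pow hn).trans (Nat.pow_le_pow_left ho _)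
    have h2 : o ^ n = o ^ (n - 1) * o := by
      rw [← pow_succ]
      congr 1
      omega
    calc 256 * n ^ 6 * o = 256 * (n * (n ^ 5 * o)) := by ring
      _ ≤ 256 * (n * (o ^ (n - 1) * o)) := by gcongr
      _ = 256 * (n * o ^ n) := by rw [h2]
  obtain ⟨t, ht⟩ : ∃ t, n = t + 1 + s := ⟨n - 1 - s, by omega⟩
  have ht0 : 0 < t := by omega
  -- Since `0 < t`, cell 0 keeps all its bits even if `r = ℓ`.
  let k : Fin n := ⟨0, by omega⟩
  have hbk : Memory.bitsBelow n t ℓ r k ≠ 0 := by simp [Memory.bitsBelow, k, ht0, hℓ]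
  have hok : 3 ≤ Memory.modBelow n t o k := by simp [Memory.modBelow, k, ho]
  have hd : n ≤ 2 ^ Nat.clog 2 n := Nat.le_pow_clog (by norm_num) _
  obtain ⟨σ, z₀, hσ, hcyc⟩ := Memory.exists_gates_cycle_compl_singleton
    (b := Memory.bitsBelow n t ℓ r) (o := Memory.modBelow n t o) hbk hok hd
  have h4 : 4 ^ Nat.clog 2 n ≤ 4 * n ^ 2 := by
    have h1 := Nat.pow_clog_le_mul (b := 2) (x := n) (by norm_num) (by omega)
    calc 4 ^ Nat.clog 2 n = (2 ^ Nat.clog 2 n) ^ 2 := by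
          rw [← pow_mul, mul_comm, pow_mul]; norm_num
      _ ≤ (2 * n) ^ 2 := Nat.pow_le_pow_left h1 2
      _ = 4 * n ^ 2 := by ring
  have hgates : 2 * n + n * (2 * 4 ^ Nat.clog 2 n + 2) + 4 ^ Nat.clog 2 n ≤ 2 ^ r * m ^ s := by
    refine le_trans ?_ hlow
    calc 2 * n + n * (2 * 4 ^ Nat.clog 2 n + 2) + 4 ^ Nat.clog 2 n
        ≤ 2 * n + n * (2 * (4 * n ^ 2) + 2) + 4 * n ^ 2 := by gcongr
      _ = 8 * n ^ 3 + 4 * n ^ 2 + 4 * n := by ring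
      _ ≤ 16 * n ^ 3 := by nlinarith [Nat.mul_le_mul hn hn, sq_nonneg n, pow_succ n 2]
  have : Fact (1 < Memory.modBelow n t o k) := ⟨by omega⟩
  obtain ⟨C, T, h1, h2, h3, h4, h5⟩ := Memory.exists_counter_of_pointer hm hr ht
    (hσ.mono hgates) z₀ hcyc ⟨Memory.shift k 1 z₀, fun h => by
      have h' := congr_arg Prod.snd (congr_fun h k)
      rw [Memory.shift_apply_same] at h'
      simp at h'⟩
  exact ⟨C, T, h1, h2, by omega, h4, h5⟩

/-! ### Logarithmic bounds and conclusion -/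

theorem natCast_le_logb_of_pow_le {m s : ℕ} {x : ℝ} (hm : 1 < m) (hx : 0 < x)
    (h : (m : ℝ) ^ s ≤ x) : (s : ℝ) ≤ Real.logb m x := by
  rw [Real.le_logb_iff_rpow_le (by exact_mod_cast hm) hx, Real.rpow_natCast]
  exact h

theorem logb_two_pow_le {m : ℕ} (hm : 2 ≤ m) (k : ℕ) : Real.logb m (2 ^ k) ≤ k := by
  have hm' : (2 : ℝ) ≤ m := by exact_mod_cast hm
  rw [Real.logb_le_iff_le_rpow (by linarith) (by positivity), Real.rpow_natCast]
  exact pow_le_pow_left₀ (by norm_num) hm' k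

theorem one_le_orderOf_two {o : ℕ} (ho : Odd o) : 1 ≤ orderOf (2 : ZMod o) := by
  have : NeZero o := ⟨ho.pos.ne'⟩
  have h : IsUnit ((2 : ℕ) : ZMod o) := (ZMod.isUnit_iff_coprime 2 o).2 ho.coprime_two_left
  obtain ⟨u, hu⟩ := h
  have hu' : (u : ZMod o) = 2 := by simpa using hu
  rw [← hu', orderOf_units]
  exact orderOf_pos u

theorem mainTheorem4 :
    ∃ A K : ℝ, 0 < A ∧ 0 < K ∧
      ∀ (m ℓ o n : ℕ) [NeZero m], Even m → Odd o → m = 2 ^ ℓ * o → 1 ≤ n →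
        ∃ (C : CyclicCounter (Fin n → ZMod m)) (T : DecisionAssignmentTree (ZMod m) n),
          C.IsQuasiGray 3 ∧
          T.Computes C ∧
          (m : ℝ) ^ n - A * ((n : ℝ) * (o : ℝ) ^ n) ≤ (C.length : ℝ) ∧
          (T.readComplexity : ℝ) ≤ K * (Real.logb (m : ℝ) (n : ℝ) + (orderOf (2 : ZMod o) : ℝ)) ∧
          T.writeComplexity ≤ 3 := by
  -- 256 is the loss for `o ≥ 3`; 22 covers `n < 20`, where up to `n + 2 ≤ 21` reads are allowed.
  refine ⟨256, 22, by norm_num, by norm_num, fun m ℓ o n _ hme hoo hm hn => ?_⟩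
  have hℓ : ℓ ≠ 0 := by
    rintro rfl
    rw [pow_zero, one_mul] at hm
    exact (Nat.not_even_iff_odd.2 hoo) (hm ▸ hme)
  have hm2 : 2 ≤ m := Nat.le_of_dvd (Nat.pos_of_ne_zero (NeZero.ne m)) hme.two_dvd
  have hm1 : (1 : ℝ) < m := by exact_mod_cast (by omega : 1 < m)
  have hord : (1 : ℝ) ≤ orderOf (2 : ZMod o) := by exact_mod_cast one_le_orderOf_two hoo
  have hn1 : (1 : ℝ) ≤ n := by exact_mod_cast hn
  have hlog : 0 ≤ Real.logb m n := Real.logb_nonneg hm1 hn1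
  suffices h : ∃ R : ℕ, (R : ℝ) ≤ 22 * (Real.logb m n + 1) ∧
      ∃ (C : CyclicCounter (Fin n → ZMod m)) (T : DecisionAssignmentTree (ZMod m) n),
        C.IsQuasiGray 3 ∧ T.Computes C ∧ m ^ n ≤ C.length + 256 * (n * o ^ n) ∧
          T.readComplexity ≤ R ∧ T.writeComplexity ≤ 3 by
    obtain ⟨R, hR, C, T, h1, h2, h3, h4, h5⟩ := h
    refine ⟨C, T, h1, h2, ?_, ?_, h5⟩
    · have : (m : ℝ) ^ n ≤ C.length + 256 * (n * (o : ℝ) ^ n) := by exact_mod_cast h3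
      linarith
    · have : (T.readComplexity : ℝ) ≤ R := by exact_mod_cast h4
      linarith
  rcases lt_or_ge n 20 with hn20 | hn20
  · have : NeZero n := ⟨by omega⟩
    obtain ⟨C, T, h1, h2, h3, h4, h5⟩ := exists_full_counter n m
    refine ⟨n + 2, ?_, C, T, h1, h2, by omega, h4, h5⟩
    have : (n : ℝ) ≤ 19 := by exact_mod_cast (by omega : n ≤ 19)
    push_cast
    linarith
  obtain ho1 | ho3 : o = 1 ∨ 3 ≤ o := by
    obtain ⟨j, hj⟩ := hoo
    omega
  · subst ho1
    obtain rfl : m = 2 ^ ℓ := by simpa using hm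
    obtain ⟨s, hs, C, T, h1, h2, h3, h4, h5⟩ := exists_counter_two_pow hn20 hℓ
    refine ⟨s + 3, ?_, C, T, h1, h2, by simp; omega, h4, h5⟩
    have h6 : (s : ℝ) ≤ Real.logb (2 ^ ℓ : ℕ) (2 ^ 2 * n) :=
      natCast_le_logb_of_pow_le (by omega) (by positivity) (by norm_num; exact_mod_cast hs)
    rw [Real.logb_mul (by norm_num) (by positivity)] at h6
    have h7 := logb_two_pow_le hm2 2
    push_cast at *
    linarith
  · obtain ⟨s, hs, C, T, h1, h2, h3, h4, h5⟩ := exists_counter_odd_ge_three hm hn20 hℓ ho3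
    refine ⟨s + 3, ?_, C, T, h1, h2, h3, h4, h5⟩
    have h6 : ((s - 1 : ℕ) : ℝ) ≤ Real.logb m (2 ^ 4 * (n : ℝ) ^ 3) :=
      natCast_le_logb_of_pow_le (by omega) (by positivity) (by norm_num; exact_mod_cast hs)
    rw [Real.logb_mul (by norm_num) (by positivity), Real.logb_pow _ (n : ℝ)] at h6
    have h7 := logb_two_pow_le hm2 4
    have h8 : (s : ℝ) ≤ ((s - 1 : ℕ) : ℝ) + 1 := by exact_mod_cast (by omega : s ≤ s - 1 + 1)
    push_cast at *
    linarith
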